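/- Let $d\ge 1$ and $O_d\ge 1$ be fixed integers, and let $Z_1,Z_2,\dots$ be independent, identically distributed random vectors in $\mathbb{R}^d$, with coordinates $Z_n=(Z_{n1},\dots,Z_{nd})$. Assume that their common law has a Lebesgue density $f$, with marginal densities $f_1,\dots,f_d$; that $\prod_{i=1}^d f_i(z_i)=0$ for almost every $z$ with $f(z)=0$ (overlap: the product of the marginal laws is absolutely continuous with respect to the joint law); and that $\mathbb{E}|Z_{1i}|^{O_d}<\infty$ for every $i$. Let $K:\mathbb{R}\to[0,\infty)$ be a kernel that is symmetric, nonincreasing on $[0,\infty)$, with $\int K(u)\,du=1$ and $\int |u|^{O_d}K(u)\,du<\infty$. For each sample size $N$ let $h_1,\dots,h_d>0$ be bandwidths (depending on $N$) and define the kernel density estimators $$\hat f(Z_{ni})=\frac{1}{N h_i}\sum_{m=1}^N K\Big(\frac{Z_{ni}-Z_{mi}}{h_i}\Big),\qquad \hat f(Z_{n1},\dots,Z_{nd})=\frac{1}{N h_1\cdots h_d}\sum_{m=1}^N\prod_{i=1}^d K\Big(\frac{Z_{ni}-Z_{mi}}{h_i}\Big).$$ For weights $W=(w_1,\dots,w_N)$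 let $$L_d(W)=\sum_{i=1}^d\sum_{a=1}^{O_d}\sum_{b=1}^{O_d}\sum_{j\ne i}\Big(\frac1N\sum_{n=1}^N Z_{ni}^a Z_{nj}^b w_n-\Big(\frac1N\sum_{n=1}^N Z_{ni}^a w_n\Big)\Big(\frac1N\sum_{n=1}^N Z_{nj}^b w_n\Big)\Big)^2 .$$ Suppose that, as $N\to\infty$, $h_i\to 0$ for $i=1,\dots,d$ and $N h_1\cdots h_d\to\infty$. Then, with probability $1$: (i) there are weights $W=W^{(N)}$ with $w_n\ge 0$ and $\sum_{n=1}^N w_n=N$ for every $N$, such that $L_d(W)\to 0$ as $N\to\infty$; (ii) the kernel-density ratio $$w_n^*=\frac{\prod_{i=1}^d \hat f(Z_{ni})}{\hat f(Z_{n1},\dots,Z_{nd})}$$ is well defined (its denominator is positive) and nonnegative for every $N$ and every $n\le N$, and $L_d(W^*)\to 0$ as $N\to\infty$ for $W^*=(w_1^*,\dots,w_N^*)$. -/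

import Mathlib

open MeasureTheory ProbabilityTheory Filter Topology

noncomputable section

namespace Decorrelation

/-- A smoothing kernel on the line: a probability density that is symmetric about `0` and
nonincreasing away from `0` (for instance the uniform, triangular, Epanechnikov or Gaussian
kernel). -/
structure IsSmoothingKernel (K : ℝ → ℝ) : Prop where
  nonneg : ∀ u, 0 ≤ K u
  even : ∀ u, K (-u) = K u
  antitone : AntitoneOn K (Set.Ici 0)
  integrable : Integrable K
  integral_eq_one : ∫ u, K u = 1

/-- The univariate kernel density estimator with kernel `K` and bandwidth `b`, built from the
sample `x 0, …, x (N - 1)` and evaluated at the point `t`. -/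
def marginalKDE (K : ℝ → ℝ) (b : ℝ) {N : ℕ} (x : Fin N → ℝ) (t : ℝ) : ℝ :=
  (∑ m, K ((t - x m) / b)) / ((N : ℝ) * b)

/-- The `d`-variate (product) kernel density estimator with kernel `K` and bandwidths
`b 0, …, b (d - 1)`, built from the sample `Z 0, …, Z (N - 1)` and evaluated at the point `z`. -/
def jointKDE (K : ℝ → ℝ) {d : ℕ} (b : Fin d → ℝ) {N : ℕ} (Z : Fin N → Fin d → ℝ)
    (z : Fin d → ℝ) : ℝ :=
  (∑ m, ∏ i, K ((z i - Z m i) / b i)) / ((N : ℝ) * ∏ i, b i)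

/-- The weights `w*_n`: the product of the estimated marginal densities over the estimated joint
density, at the `n`-th sample point. -/
def kdeWeight (K : ℝ → ℝ) {d : ℕ} (b : Fin d → ℝ) {N : ℕ} (Z : Fin N → Fin d → ℝ)
    (n : Fin N) : ℝ :=
  (∏ i, marginalKDE K (b i) (fun m => Z m i) (Z n i)) / jointKDE K b Z (Z n)

/-- The decorrelation loss of the `N × d` data matrix `Z` under the sample weights `w`, for all
moment orders up to `O`. The inner sum over `j ≠ i` is the squared Euclidean norm of the row vector
indexed by the remaining coordinates. -/
def decorrelationLoss (O : ℕ) {d N : ℕ} (Z : Fin N → Fin d → ℝ) (w : Fin N → ℝ) : ℝ :=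
  ∑ i, ∑ a ∈ Finset.Icc 1 O, ∑ b ∈ Finset.Icc 1 O, ∑ j ∈ Finset.univ.erase i,
    ((∑ n, Z n i ^ a * w n * Z n j ^ b) / (N : ℝ)
      - ((∑ n, Z n i ^ a * w n) / (N : ℝ)) * ((∑ n, Z n j ^ b * w n) / (N : ℝ))) ^ 2

/-- The data matrix formed by the first `N` terms of a sequence of `d`-dimensional vectors. -/
def sample {d : ℕ} (z : ℕ → Fin d → ℝ) (N : ℕ) : Fin N → Fin d → ℝ := fun n => z n

end Decorrelation

end

open Decorrelation

noncomputable section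

namespace Decorrelation

/-! Write k for the product kernel, π for the joint law, P for the product of its marginals, and q_n
for the reciprocal of Σ_m k(Z_n, Z_m) (`invMass`). Up to the factor N, the weight w*_n is q_n times
the smoothing at Z_n of the product of the empirical marginals. It is enough that the moments of the
sample under w*/N converge to those of P: mixed moments factorise under P, so every term of the loss
tends to 0. For (i) the same weights are divided by their total mass, which tends to 1.

The denominator has no useful lower bound, since the joint density may be arbitrarily small. The
covering inequality `sum_invMass_mul_le` takes its place: sample points in a common box of sides r
h_i all contribute to each other's mass, so their q_n sum to at most K(r)^{-d}. Hence Σ_n q_n k(Z_n,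
y) is bounded uniformly in y, the sample and the bandwidths, and an error that is small in L¹ stays
small after smoothing and division.

Weak convergence (`tendsto_sum_productWeight_mul`) is then a chain of replacements. The product of
the empirical marginals becomes P; the density dP/dπ, which exists by overlap, becomes a continuous
compactly supported function close to it in L¹(π); that function is moved out of the smoothing; and
π becomes the empirical measure. At this point the smoothed empirical measure cancels q_n exactly
and an ordinary sample mean remains.

The changes of measure rest on total variation closeness on grids of mesh proportional to h
(`ae_merge_empirical`). Most of the mass lies in O(1/∏ h_i) = o(N) cells, so Hoeffding's bound beats
the union over all sign patterns on them. What happens inside a cell is controlled by the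
monotonicity of K (`abs_sum_invMass_mul_sub_le`).

Passing from compact support to moments needs uniform integrability
(`eventually_sum_productWeight_tail_le`): the weight ∏(1+|x_i|)^p is transferred from Z_n to the
smoothing variable, where it factorises over the empirical marginals, so one-dimensional moments
suffice. -/

/-- The kernel `K` widened by `s`: the supremum of `K` over `[u - s, u + s]`. -/
def widen (K : ℝ → ℝ) (s u : ℝ) : ℝ := K (max (|u| - s) 0)

/-- The kernel `K` narrowed by `s`: a lower bound of `K` over `[u - s, u + s]`. -/
def narrow (K : ℝ → ℝ) (s u : ℝ) : ℝ := K (|u| + s)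

lemma setIntegral_comp_add_Ioi (f : ℝ → ℝ) (a s : ℝ) :
    ∫ u in Set.Ioi a, f (u + s) = ∫ u in Set.Ioi (a + s), f u := by
  simpa using (measurePreserving_add_right volume s).setIntegral_preimage_emb
    (measurableEmbedding_addRight s) f (Set.Ioi (a + s))

/-! ### Monotone kernels and their widened and narrowed versions -/

namespace IsSmoothingKernel

variable {K : ℝ → ℝ}

lemma apply_abs (hK : IsSmoothingKernel K) (u : ℝ) : K |u| = K u := by
  rcases abs_choice u with h | h <;> rw [h]
  exact hK.even u

lemma apply_le_apply (hK : IsSmoothingKernel K) {u v : ℝ} (h : |u| ≤ |v|) : K v ≤ K u := by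
  rw [← hK.apply_abs u, ← hK.apply_abs v]
  exact hK.antitone (abs_nonneg u) (abs_nonneg v) h

/-- Integrability gives measurability only almost everywhere; the genuine one comes from `K` being
an antitone function of |u|. -/
lemma measurable (hK : IsSmoothingKernel K) : Measurable K := by
  have h1 : Antitone fun u => K (max u 0) := fun u v h =>
    hK.antitone (Set.mem_Ici.2 (le_max_right _ _)) (Set.mem_Ici.2 (le_max_right _ _)) (max_le_max_right _ h)
  have h2 : K = (fun u => K (max u 0)) ∘ fun u => |u| := by
    ext u
    simp [hK.apply_abs, abs_nonneg]
  rw [h2]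
  exact h1.measurable.comp (by fun_prop)

lemma measurable_widen (hK : IsSmoothingKernel K) (s : ℝ) : Measurable (widen K s) :=
  hK.measurable.comp (by fun_prop)

lemma measurable_narrow (hK : IsSmoothingKernel K) (s : ℝ) : Measurable (narrow K s) :=
  hK.measurable.comp (by fun_prop)

lemma le_zero (hK : IsSmoothingKernel K) (u : ℝ) : K u ≤ K 0 := hK.apply_le_apply (by simp)

/-- A kernel vanishing on (0, ∞) would have integral 0. Such an `r` sets the side of the covering
boxes, since `K` is at least `K r` on [-r, r]. -/
lemma exists_pos (hK : IsSmoothingKernel K) : ∃ r, 0 < r ∧ 0 < K r := by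
  by_contra! h
  have h0 : ∀ᵐ u : ℝ, K u = 0 := by
    filter_upwards [compl_mem_ae_iff.2 (measure_singleton (0 : ℝ))] with u hu
    rw [← hK.apply_abs]
    exact le_antisymm (h _ (abs_pos.2 hu)) (hK.nonneg _)
  have := hK.integral_eq_one
  rw [integral_congr_ae (g := fun _ => 0) h0] at this
  simp at this

lemma zero_pos (hK : IsSmoothingKernel K) : 0 < K 0 := by
  obtain ⟨r, _, h⟩ := hK.exists_pos
  exact h.trans_le (hK.le_zero r)

lemma widen_nonneg (hK : IsSmoothingKernel K) (s u : ℝ) : 0 ≤ widen K s u := hK.nonneg _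

lemma narrow_nonneg (hK : IsSmoothingKernel K) (s u : ℝ) : 0 ≤ narrow K s u := hK.nonneg _

lemma widen_le_widen (hK : IsSmoothingKernel K) {s t u v : ℝ} (h : |u - v| ≤ t - s) :
    widen K s v ≤ widen K t u := by
  refine hK.antitone (Set.mem_Ici.2 (le_max_right _ _)) (Set.mem_Ici.2 (le_max_right _ _)) (max_le_max_right _ ?_)
  have := abs_sub_abs_le_abs_sub u v
  linarith

lemma narrow_le_narrow (hK : IsSmoothingKernel K) {s t u v : ℝ} (hs : 0 ≤ s)
    (h : |u - v| ≤ t - s) : narrow K t u ≤ narrow K s v := by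
  have h1 := abs_sub_abs_le_abs_sub v u
  have h2 := abs_nonneg (u - v)
  rw [abs_sub_comm] at h1
  exact hK.antitone (a := |v| + s) (b := |u| + t) (by simp; positivity)
    (by simp; linarith [abs_nonneg u]) (by linarith)

lemma widen_zero (hK : IsSmoothingKernel K) (u : ℝ) : widen K 0 u = K u := by
  simp [widen, hK.apply_abs, abs_nonneg]

lemma narrow_zero (hK : IsSmoothingKernel K) (u : ℝ) : narrow K 0 u = K u := by
  simp [narrow, hK.apply_abs]

lemma le_widen (hK : IsSmoothingKernel K) {s u v : ℝ} (h : |u - v| ≤ s) :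
    K v ≤ widen K s u := by
  simpa [hK.widen_zero] using hK.widen_le_widen (s := 0) (t := s) (u := u) (v := v) (by simpa)

lemma narrow_le (hK : IsSmoothingKernel K) {s u v : ℝ} (h : |u - v| ≤ s) :
    narrow K s u ≤ K v := by
  simpa [hK.narrow_zero] using
    hK.narrow_le_narrow (s := 0) (t := s) (u := u) (v := v) le_rfl (by simpa)

lemma widen_le_zero (hK : IsSmoothingKernel K) (s u : ℝ) : widen K s u ≤ K 0 := hK.le_zero _

lemma integrable_moment (hK : IsSmoothingKernel K) {p : ℕ}
    (hp : Integrable fun u => |u| ^ p * K u) {c : ℝ} (hc : 0 ≤ c) :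
    Integrable fun u => (c + |u|) ^ p * K u := by
  have hi : Integrable fun u => 2 ^ (p - 1) * (c ^ p * K u + |u| ^ p * K u) :=
    ((hK.integrable.const_mul _).add hp).const_mul _
  refine hi.mono' ((by fun_prop : Measurable fun u : ℝ => (c + |u|) ^ p).mul
    hK.measurable).aestronglyMeasurable (ae_of_all _ fun u => ?_)
  have h0 : 0 ≤ (c + |u|) ^ p * K u := mul_nonneg (by positivity) (hK.nonneg _)
  rw [Real.norm_of_nonneg h0, ← add_mul, ← mul_assoc]
  exact mul_le_mul_of_nonneg_right (add_pow_le hc (abs_nonneg u) p) (hK.nonneg u)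

/-- The widened kernel inherits the moments of the kernel. -/
lemma integrable_moment_widen (hK : IsSmoothingKernel K) {p : ℕ}
    (hp : Integrable fun u => |u| ^ p * K u) {c s : ℝ} (hc : 0 ≤ c) (hs : 0 ≤ s) :
    Integrable fun u => (c + |u|) ^ p * widen K s u := by
  -- The dominating function has three pieces: `K` shifted by `s` for u > s, shifted by `-s` for u <
  -- -s, and the plateau of height `K 0` between them.
  have h1 := hK.integrable_moment hp (add_nonneg hc hs)
  have h2 := h1.comp_sub_right s
  have h3 := h1.comp_add_right s
  have h4 : Integrable (Set.indicator (Set.Icc (-s) s) fun _ : ℝ => (c + s) ^ p * K 0) :=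
    (integrable_indicator_iff measurableSet_Icc).2 (integrableOn_const (by simp))
  refine ((h2.add h3).add h4).mono' ((by fun_prop : Measurable fun u : ℝ => (c + |u|) ^ p).mul
    (hK.measurable_widen s)).aestronglyMeasurable (ae_of_all _ fun u => ?_)
  have h0 : 0 ≤ (c + |u|) ^ p * widen K s u := mul_nonneg (by positivity) (hK.nonneg _)
  have g2 : 0 ≤ (c + s + |u - s|) ^ p * K (u - s) := mul_nonneg (by positivity) (hK.nonneg _)
  have g3 : 0 ≤ (c + s + |u + s|) ^ p * K (u + s) := mul_nonneg (by positivity) (hK.nonneg _)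
  have g4 : 0 ≤ Set.indicator (Set.Icc (-s) s) (fun _ : ℝ => (c + s) ^ p * K 0) u :=
    Set.indicator_nonneg (fun _ _ => mul_nonneg (by positivity) (hK.nonneg _)) _
  rw [Real.norm_of_nonneg h0]
  simp only [Pi.add_apply]
  rcases le_or_gt |u| s with hu | hu
  · rw [Set.indicator_of_mem (Set.mem_Icc.2 (abs_le.1 hu))] at g4 ⊢
    have : (c + |u|) ^ p * widen K s u ≤ (c + s) ^ p * K 0 := by
      gcongr
      · exact hK.nonneg _
      · exact hK.widen_le_zero _ _
    linarith
  · rcases le_total 0 u with h | h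
    · have e : widen K s u = K (u - s) := by
        rw [abs_of_nonneg h] at hu
        rw [widen, abs_of_nonneg h, max_eq_left (by linarith)]
      have : (c + |u|) ^ p * widen K s u ≤ (c + s + |u - s|) ^ p * K (u - s) := by
        rw [e]
        refine mul_le_mul_of_nonneg_right (pow_le_pow_left₀ (by positivity) ?_ _) (hK.nonneg _)
        have := abs_sub_abs_le_abs_sub u s
        rw [abs_of_nonneg hs] at this
        linarith
      linarith
    · have e : widen K s u = K (u + s) := by
        rw [abs_of_nonpos h] at hu
        rw [widen, abs_of_nonpos h, max_eq_left (by linarith), ← hK.even]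
        congr 1
        ring
      have : (c + |u|) ^ p * widen K s u ≤ (c + s + |u + s|) ^ p * K (u + s) := by
        rw [e]
        refine mul_le_mul_of_nonneg_right (pow_le_pow_left₀ (by positivity) ?_ _) (hK.nonneg _)
        have := abs_sub_abs_le_abs_sub u (-s)
        rw [abs_neg, abs_of_nonneg hs, sub_neg_eq_add] at this
        linarith
      linarith

lemma integrable_widen (hK : IsSmoothingKernel K) {s : ℝ} (hs : 0 ≤ s) :
    Integrable (widen K s) := by
  simpa using hK.integrable_moment_widen (p := 0) (by simpa using hK.integrable) le_rfl hs

lemma narrow_le_widen (hK : IsSmoothingKernel K) {s : ℝ} (hs : 0 ≤ s) (u : ℝ) :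
    narrow K s u ≤ widen K s u :=
  (hK.narrow_le (v := u) (by simpa)).trans (hK.le_widen (by simpa))

lemma integrable_narrow (hK : IsSmoothingKernel K) {s : ℝ} (hs : 0 ≤ s) :
    Integrable (narrow K s) := by
  refine (hK.integrable_widen hs).mono' (hK.measurable_narrow s).aestronglyMeasurable
    (ae_of_all _ fun u => ?_)
  rw [Real.norm_of_nonneg (hK.narrow_nonneg s u)]
  exact hK.narrow_le_widen hs u

/-- A comparison of the integrals of the widened and the narrowed kernel. -/
lemma integral_widen_le (hK : IsSmoothingKernel K) {s : ℝ} (hs : 0 ≤ s) :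
    ∫ u, widen K s u ≤ 1 + 2 * s * K 0 := by
  -- Widening inserts a plateau of height `K 0` and length 2s between the two halves of `K`.
  have e : ∫ u, widen K s u = 2 * ∫ u in Set.Ioi 0, K (max (u - s) 0) :=
    integral_comp_abs (f := fun u => K (max (u - s) 0))
  have e1 : ∫ u, K u = 2 * ∫ u in Set.Ioi 0, K u := by
    rw [← integral_comp_abs]
    simp_rw [hK.apply_abs]
  rw [hK.integral_eq_one] at e1
  have hw : IntegrableOn (fun u => K (max (u - s) 0)) (Set.Ioi 0) :=
    (hK.integrable_widen hs).integrableOn.congr_fun (fun u hu => by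
      simp only [widen, abs_of_pos (Set.mem_Ioi.1 hu)]) measurableSet_Ioi
  have e2 : ∫ u in Set.Ioi 0, K (max (u - s) 0)
      = (∫ u in Set.Ioc 0 s, K (max (u - s) 0)) + ∫ u in Set.Ioi s, K (max (u - s) 0) := by
    rw [← setIntegral_union Set.Ioc_disjoint_Ioi_same measurableSet_Ioi
      (hw.mono_set Set.Ioc_subset_Ioi_self) (hw.mono_set (Set.Ioi_subset_Ioi hs)),
      Set.Ioc_union_Ioi_eq_Ioi hs]
  have e3 : ∫ u in Set.Ioc 0 s, K (max (u - s) 0) = s * K 0 := by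
    rw [setIntegral_congr_fun (g := fun _ => K 0) measurableSet_Ioc fun u hu => by
      simp [hu.2]]
    simp [hs]
  have e4 : ∫ u in Set.Ioi s, K (max (u - s) 0) = ∫ u in Set.Ioi 0, K u := by
    rw [setIntegral_congr_fun (g := fun u => K (u - s)) measurableSet_Ioi fun u hu => by
      simp [(Set.mem_Ioi.1 hu).le]]
    simpa [sub_eq_add_neg] using setIntegral_comp_add_Ioi K s (-s)
  rw [e, e2, e3, e4]
  linarith

/-- Narrowing cuts out the part of `K` over [-s, s], of mass at most 2s `K 0`, and closes the gap.
-/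
lemma le_integral_narrow (hK : IsSmoothingKernel K) {s : ℝ} (hs : 0 ≤ s) :
    1 - 2 * s * K 0 ≤ ∫ u, narrow K s u := by
  have e : ∫ u, narrow K s u = 2 * ∫ u in Set.Ioi 0, K (u + s) :=
    integral_comp_abs (f := fun u => K (u + s))
  have e1 : ∫ u, K u = 2 * ∫ u in Set.Ioi 0, K u := by
    rw [← integral_comp_abs]
    simp_rw [hK.apply_abs]
  rw [hK.integral_eq_one] at e1
  have e2 : ∫ u in Set.Ioi 0, K u = (∫ u in Set.Ioc 0 s, K u) + ∫ u in Set.Ioi s, K u := by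
    rw [← setIntegral_union Set.Ioc_disjoint_Ioi_same measurableSet_Ioi
      hK.integrable.integrableOn hK.integrable.integrableOn, Set.Ioc_union_Ioi_eq_Ioi hs]
  have e3 : ∫ u in Set.Ioc 0 s, K u ≤ s * K 0 := by
    have := setIntegral_mono (μ := volume) (s := Set.Ioc 0 s) hK.integrable.integrableOn
      (integrableOn_const (C := K 0) (by simp)) fun u => hK.le_zero u
    simpa [hs] using this
  have e4 : ∫ u in Set.Ioi 0, K (u + s) = ∫ u in Set.Ioi s, K u := by
    simpa using setIntegral_comp_add_Ioi K 0 s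
  rw [e, e4]
  linarith

lemma tendsto_integral_widen (hK : IsSmoothingKernel K) :
    Tendsto (fun s => ∫ u, widen K s u) (𝓝[≥] 0) (𝓝 1) := by
  have h : Tendsto (fun s : ℝ => 1 + 2 * s * K 0) (𝓝[≥] 0) (𝓝 1) :=
    tendsto_nhdsWithin_of_tendsto_nhds (Continuous.tendsto' (by fun_prop) _ _ (by simp))
  refine tendsto_of_tendsto_of_tendsto_of_le_of_le' tendsto_const_nhds h ?_ ?_
  · filter_upwards [self_mem_nhdsWithin] with s hs
    rw [← hK.integral_eq_one]
    exact integral_mono hK.integrable (hK.integrable_widen hs) fun u => hK.le_widen (by simpa)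
  · filter_upwards [self_mem_nhdsWithin] with s hs using hK.integral_widen_le hs

lemma tendsto_integral_narrow (hK : IsSmoothingKernel K) :
    Tendsto (fun s => ∫ u, narrow K s u) (𝓝[≥] 0) (𝓝 1) := by
  have h : Tendsto (fun s : ℝ => 1 - 2 * s * K 0) (𝓝[≥] 0) (𝓝 1) :=
    tendsto_nhdsWithin_of_tendsto_nhds (Continuous.tendsto' (by fun_prop) _ _ (by simp))
  refine tendsto_of_tendsto_of_tendsto_of_le_of_le' h tendsto_const_nhds ?_ ?_
  · filter_upwards [self_mem_nhdsWithin] with s hs using hK.le_integral_narrow hs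
  · filter_upwards [self_mem_nhdsWithin] with s hs
    rw [← hK.integral_eq_one]
    exact integral_mono (hK.integrable_narrow hs) hK.integrable fun u => hK.narrow_le (by simpa)

end IsSmoothingKernel

/-! ### Inverse kernel masses and the covering inequality -/

/-- The unnormalised product kernel with bandwidths `h`. -/
def prodKernel (K : ℝ → ℝ) {d : ℕ} (h x y : Fin d → ℝ) : ℝ := ∏ i, K ((x i - y i) / h i)

/-- The inverse of the kernel mass which the sample `X` puts around its `n`-th point. -/
def invMass (K : ℝ → ℝ) {d N : ℕ} (h : Fin d → ℝ) (X : Fin N → Fin d → ℝ) (n : Fin N) : ℝ :=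
  (∑ m, prodKernel K h (X n) (X m))⁻¹

/-- A profile with as many moments as needed that dominates the kernel. -/
def envelope (K : ℝ → ℝ) (p : ℕ) (v : ℝ) : ℝ := (1 + |v|) ^ p * widen K 1 v

section Cover

variable {K : ℝ → ℝ} {d N : ℕ} {h : Fin d → ℝ} (X : Fin N → Fin d → ℝ)

lemma prodKernel_nonneg (hK : IsSmoothingKernel K) (x y : Fin d → ℝ) : 0 ≤ prodKernel K h x y :=
  Finset.prod_nonneg fun _ _ => hK.nonneg _

lemma prodKernel_self (x : Fin d → ℝ) : prodKernel K h x x = K 0 ^ d := by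
  simp [prodKernel]

/-- The diagonal term m = n is already positive, so `invMass` is never the inverse of 0. -/
lemma sum_prodKernel_pos (hK : IsSmoothingKernel K) (n : Fin N) :
    0 < ∑ m, prodKernel K h (X n) (X m) :=
  Finset.sum_pos' (fun _ _ => prodKernel_nonneg hK _ _)
    ⟨n, Finset.mem_univ _, by rw [prodKernel_self]; exact pow_pos hK.zero_pos d⟩

lemma invMass_nonneg (hK : IsSmoothingKernel K) (n : Fin N) : 0 ≤ invMass K h X n :=
  inv_nonneg.2 (sum_prodKernel_pos X hK n).le

/-- The inverse masses of the sample points in a small box have a bounded sum. -/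
lemma sum_invMass_box_le (hK : IsSmoothingKernel K) (hpos : ∀ i, 0 < h i) {r : ℝ}
    (hKr : 0 < K r) (x : Fin d → ℝ) :
    ∑ n with ∀ i, |X n i - x i| ≤ r / 2 * h i, invMass K h X n ≤ (K r ^ d)⁻¹ := by
  classical
  set S := Finset.univ.filter fun n => ∀ i, |X n i - x i| ≤ r / 2 * h i with hS
  have hc : 0 < K r ^ d := pow_pos hKr d
  rcases S.eq_empty_or_nonempty with h0 | h0
  · rw [h0, Finset.sum_empty]
    positivity
  have hcard : (0 : ℝ) < S.card := by exact_mod_cast h0.card_pos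
  -- Two points of the box differ by at most r h_i in each coordinate, so each has mass at least |S|
  -- K(r)^d. Summing |S| such inverses gives K(r)^{-d}, however many points the box holds.
  have hle : ∀ n ∈ S, invMass K h X n ≤ (S.card * K r ^ d)⁻¹ := by
    intro n hn
    refine inv_anti₀ (by positivity) ?_
    calc (S.card : ℝ) * K r ^ d = ∑ m ∈ S, K r ^ d := by simp
      _ ≤ ∑ m ∈ S, prodKernel K h (X n) (X m) := by
        refine Finset.sum_le_sum fun m hm => ?_
        rw [prodKernel, ← Fin.prod_const]
        refine Finset.prod_le_prod (fun _ _ => hKr.le) fun i _ => hK.apply_le_apply ?_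
        have h1 := (Finset.mem_filter.1 hn).2 i
        have h2 := (Finset.mem_filter.1 hm).2 i
        rw [abs_div, abs_of_pos (hpos i), div_le_iff₀ (hpos i)]
        have h3 : |X n i - X m i| ≤ |X n i - x i| + |X m i - x i| := by
          rw [abs_sub_comm (X m i)]
          exact abs_sub_le _ _ _
        have h4 := mul_le_mul_of_nonneg_right (le_abs_self r) (hpos i).le
        linarith
      _ ≤ ∑ m, prodKernel K h (X n) (X m) :=
        Finset.sum_le_sum_of_subset_of_nonneg (Finset.subset_univ _)
          fun _ _ _ => prodKernel_nonneg hK _ _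
  calc ∑ n ∈ S, invMass K h X n ≤ ∑ n ∈ S, (S.card * K r ^ d)⁻¹ := Finset.sum_le_sum hle
    _ = (K r ^ d)⁻¹ := by
      rw [Finset.sum_const, nsmul_eq_mul, mul_inv, ← mul_assoc, mul_inv_cancel₀ hcard.ne', one_mul]

/-- The covering inequality: sums against the inverse masses are controlled by Lebesgue
integrals of a locally dominating function. -/
lemma sum_invMass_mul_le (hK : IsSmoothingKernel K) (hpos : ∀ i, 0 < h i) {r : ℝ} (hr : 0 < r)
    (hKr : 0 < K r) {φ Φ : (Fin d → ℝ) → ℝ} (hΦ0 : ∀ x, 0 ≤ Φ x)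
    (hΦ : Integrable Φ) (hle : ∀ x x', (∀ i, |x i - x' i| ≤ r / 2 * h i) → φ x ≤ Φ x') :
    ∑ n, invMass K h X n * φ (X n) ≤ (K r ^ d)⁻¹ * (∏ i, (r * h i))⁻¹ * ∫ x, Φ x := by
  classical
  have hc : 0 < K r ^ d := pow_pos hKr d
  have hv : 0 < ∏ i, (r * h i) := Finset.prod_pos fun i _ => mul_pos hr (hpos i)
  -- `φ (X n)` is bounded by the average of `Φ` over the box of sides r h_i around `X n`. After
  -- exchanging sum and integral, the indices whose box contains x are those of the sample points in
  -- the box around x.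
  let B : Fin N → Set (Fin d → ℝ) := fun n =>
    Set.Icc (fun i => X n i - r / 2 * h i) (fun i => X n i + r / 2 * h i)
  have hB : ∀ n x, x ∈ B n ↔ ∀ i, |X n i - x i| ≤ r / 2 * h i := by
    intro n x
    simp only [B, Set.mem_Icc, Pi.le_def, abs_le]
    exact ⟨fun H i => ⟨by linarith [H.2 i], by linarith [H.1 i]⟩,
      fun H => ⟨fun i => by linarith [(H i).2], fun i => by linarith [(H i).1]⟩⟩
  have hBm : ∀ n, MeasurableSet (B n) := fun n => measurableSet_Icc
  have hvol : ∀ n, volume.real (B n) = ∏ i, (r * h i) := by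
    intro n
    rw [measureReal_def, Real.volume_Icc_pi_toReal]
    · exact Finset.prod_congr rfl fun i _ => by ring
    · intro i
      have := mul_pos hr (hpos i)
      simp only
      linarith
  have h1 : ∀ n, (∏ i, (r * h i)) * φ (X n) ≤ ∫ x, (B n).indicator Φ x := by
    intro n
    rw [integral_indicator (hBm n), ← hvol n, ← smul_eq_mul, ← setIntegral_const]
    refine setIntegral_mono_on ?_ hΦ.integrableOn (hBm n) fun x hx => hle _ _ ((hB n x).1 hx)
    exact integrableOn_const (isCompact_Icc.measure_lt_top.ne)
  have h2 : ∑ n, invMass K h X n * ∫ x, (B n).indicator Φ x ≤ (K r ^ d)⁻¹ * ∫ x, Φ x := by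
    simp_rw [← integral_const_mul]
    rw [← integral_finsetSum _ fun n _ => (hΦ.indicator (hBm n)).const_mul _]
    refine integral_mono (integrable_finsetSum _ fun n _ => (hΦ.indicator (hBm n)).const_mul _)
      (hΦ.const_mul _) fun x => ?_
    have e : ∑ n, invMass K h X n * (B n).indicator Φ x
        = (∑ n with ∀ i, |X n i - x i| ≤ r / 2 * h i, invMass K h X n) * Φ x := by
      rw [Finset.sum_mul, Finset.sum_filter]
      refine Finset.sum_congr rfl fun n _ => ?_
      simp only [Set.indicator, hB, mul_ite, mul_zero]
    simp only [e]
    exact mul_le_mul_of_nonneg_right (sum_invMass_box_le X hK hpos hKr x) (hΦ0 x)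
  rw [mul_assoc, mul_left_comm, ← div_eq_inv_mul, le_div_iff₀' hv, Finset.mul_sum]
  refine le_trans (Finset.sum_le_sum fun n _ => ?_) h2
  rw [mul_left_comm]
  exact mul_le_mul_of_nonneg_left (h1 n) (invMass_nonneg X hK n)

/-- The covering inequality for products of one-dimensional profiles. -/
lemma sum_invMass_mul_prod_le (hK : IsSmoothingKernel K) (hpos : ∀ i, 0 < h i) {r : ℝ}
    (hr : 0 < r) (hKr : 0 < K r) {ψ Ψ : Fin d → ℝ → ℝ} (hψ : ∀ i v, 0 ≤ ψ i v)
    (hΨ : ∀ i, Integrable (Ψ i)) (hle : ∀ i u v, |u - v| ≤ r / 2 → ψ i v ≤ Ψ i u)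
    (y : Fin d → ℝ) :
    ∑ n, invMass K h X n * ∏ i, ψ i ((X n i - y i) / h i)
      ≤ (K r ^ d)⁻¹ * ∏ i, (r⁻¹ * ∫ u, Ψ i u) := by
  have hΨ0 : ∀ i u, 0 ≤ Ψ i u := fun i u =>
    (hψ i u).trans (hle i u u (by simpa using (by positivity : 0 ≤ r / 2)))
  have key := sum_invMass_mul_le X hK hpos hr hKr
    (φ := fun x => ∏ i, ψ i ((x i - y i) / h i)) (Φ := fun x => ∏ i, Ψ i ((x i - y i) / h i))
    (fun x => Finset.prod_nonneg fun i _ => hΨ0 i _)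
    (Integrable.fintype_prod (f := fun i t => Ψ i ((t - y i) / h i)) (μ := fun _ => volume)
      fun i => ((hΨ i).comp_div (hpos i).ne').comp_sub_right (y i))
    (fun x x' hx => Finset.prod_le_prod (fun i _ => hψ i _) fun i _ => hle i _ _ ?_)
  -- The factor `h i` from rescaling each integral cancels the box volume, so the bound is free of
  -- the bandwidths.
  · refine key.trans (le_of_eq ?_)
    rw [integral_fintype_prod_volume_eq_prod (f := fun i t => Ψ i ((t - y i) / h i)), mul_assoc,
      ← Finset.prod_inv_distrib, ← Finset.prod_mul_distrib]
    congr 1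
    refine Finset.prod_congr rfl fun i _ => ?_
    rw [integral_sub_right_eq_self (fun t => Ψ i (t / h i)) (y i), Measure.integral_comp_div,
      smul_eq_mul, abs_of_pos (hpos i), mul_inv]
    field_simp [(hpos i).ne']
  · rw [← sub_div, abs_div, abs_of_pos (hpos i), div_le_iff₀ (hpos i), sub_sub_sub_cancel_right,
      abs_sub_comm]
    exact hx i

end Cover

/-! ### Uniform bounds for sums against the inverse masses -/

section Envelope

variable {K : ℝ → ℝ} {p : ℕ}

lemma envelope_nonneg (hK : IsSmoothingKernel K) (p : ℕ) (v : ℝ) : 0 ≤ envelope K p v :=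
  mul_nonneg (by positivity) (hK.widen_nonneg _ _)

lemma widen_le_envelope (hK : IsSmoothingKernel K) (p : ℕ) {s : ℝ} (hs : s ≤ 1) (v : ℝ) :
    widen K s v ≤ envelope K p v := by
  have h1 : widen K s v ≤ widen K 1 v := hK.widen_le_widen (by simpa)
  have h2 : 1 ≤ (1 + |v|) ^ p := one_le_pow₀ (by linarith [abs_nonneg v])
  exact h1.trans (le_mul_of_one_le_left (hK.widen_nonneg _ _) h2)

lemma pow_mul_le_envelope (hK : IsSmoothingKernel K) (p : ℕ) (v : ℝ) :
    (1 + |v|) ^ p * K v ≤ envelope K p v := by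
  refine mul_le_mul_of_nonneg_left ?_ (by positivity)
  rw [← hK.widen_zero v]
  exact hK.widen_le_widen (by simp)

lemma apply_le_envelope (hK : IsSmoothingKernel K) (p : ℕ) (v : ℝ) : K v ≤ envelope K p v := by
  rw [← hK.widen_zero v]
  exact widen_le_envelope hK p zero_le_one v

lemma envelope_le (hK : IsSmoothingKernel K) {t u v : ℝ} (h : |u - v| ≤ t) :
    envelope K p v ≤ (1 + t + |u|) ^ p * widen K (1 + t) u := by
  have h1 := abs_sub_abs_le_abs_sub v u
  rw [abs_sub_comm] at h1
  refine mul_le_mul (pow_le_pow_left₀ (by positivity) (by linarith) _)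
    (hK.widen_le_widen (by linarith)) (hK.widen_nonneg _ _) ?_
  have : 0 ≤ t := (abs_nonneg _).trans h
  positivity

/-- The product of envelopes has bounded sums against the inverse masses. -/
lemma exists_sum_envelope_le (hK : IsSmoothingKernel K) (hp : Integrable fun u => |u| ^ p * K u)
    (d : ℕ) :
    ∃ ρ, 0 ≤ ρ ∧ ∀ (N : ℕ) (X : Fin N → Fin d → ℝ) (h : Fin d → ℝ) (y : Fin d → ℝ),
      (∀ i, 0 < h i) →
        ∑ n, invMass K h X n * ∏ i, envelope K p ((X n i - y i) / h i) ≤ ρ := by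
  obtain ⟨r, hr, hKr⟩ := hK.exists_pos
  have hi : Integrable fun u => (1 + r / 2 + |u|) ^ p * widen K (1 + r / 2) u :=
    hK.integrable_moment_widen hp (by positivity) (by positivity)
  have key : ∀ (N : ℕ) (X : Fin N → Fin d → ℝ) (h : Fin d → ℝ) (y : Fin d → ℝ),
      (∀ i, 0 < h i) → ∑ n, invMass K h X n * ∏ i, envelope K p ((X n i - y i) / h i)
        ≤ (K r ^ d)⁻¹ *
          ∏ _i : Fin d, (r⁻¹ * ∫ u, (1 + r / 2 + |u|) ^ p * widen K (1 + r / 2) u) :=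
    fun N X h y hpos => sum_invMass_mul_prod_le X hK hpos hr hKr (ψ := fun _ => envelope K p)
      (Ψ := fun _ u => (1 + r / 2 + |u|) ^ p * widen K (1 + r / 2) u)
      (fun _ => envelope_nonneg hK p) (fun _ => hi) (fun _ u v huv => envelope_le hK huv) y
  refine ⟨_, ?_, key⟩
  -- For the empty sample the left side is 0, which shows that the constant is nonnegative.
  simpa using key 0 Fin.elim0 (fun _ => 1) (fun _ => 0) fun _ => one_pos

/-- The envelopes have uniformly small sums against the inverse masses off a large box. -/
lemma exists_sum_envelope_tail_le (hK : IsSmoothingKernel K)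
    (hp : Integrable fun u => |u| ^ p * K u) (d : ℕ) {ε : ℝ} (hε : 0 < ε) :
    ∃ L, ∀ (N : ℕ) (X : Fin N → Fin d → ℝ) (h : Fin d → ℝ) (y : Fin d → ℝ) (k : Fin d),
      (∀ i, 0 < h i) → ∑ n, invMass K h X n *
        (if L < |(X n k - y k) / h k| then ∏ i, envelope K p ((X n i - y i) / h i) else 0)
          ≤ ε := by
  obtain ⟨r, hr, hKr⟩ := hK.exists_pos
  set F : ℝ → ℝ := fun u => (1 + r / 2 + |u|) ^ p * widen K (1 + r / 2) u with hF
  have hi : Integrable F := hK.integrable_moment_widen hp (by positivity) (by positivity)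
  have hF0 : ∀ u, 0 ≤ F u := fun u => mul_nonneg (by positivity) (hK.widen_nonneg _ _)
  have hms : ∀ L : ℝ, MeasurableSet {u : ℝ | L < |u|} := fun L =>
    measurableSet_lt measurable_const (by fun_prop)
  have htail : Tendsto (fun L : ℝ => ∫ u, {u : ℝ | L < |u|}.indicator F u) atTop (𝓝 0) := by
    rw [← integral_zero ℝ ℝ]
    refine tendsto_integral_filter_of_dominated_convergence F
      (Eventually.of_forall fun L => (hi.indicator (hms L)).aestronglyMeasurable)
      (Eventually.of_forall fun L => ae_of_all _ fun u => ?_) hi (ae_of_all _ fun u => ?_)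
    · rw [Real.norm_of_nonneg (Set.indicator_nonneg (fun u _ => hF0 u) _)]
      exact Set.indicator_le_self' (fun u _ => hF0 u) _
    · refine tendsto_const_nhds.congr' ?_
      filter_upwards [eventually_ge_atTop |u|] with L hL
      rw [Set.indicator_of_notMem (by simpa using hL)]
  have hlim : Tendsto (fun L : ℝ => (K r ^ d)⁻¹ * (r⁻¹ * ∫ u, {u : ℝ | L < |u|}.indicator F u) *
      (r⁻¹ * ∫ u, F u) ^ (d - 1)) atTop (𝓝 0) := by
    simpa using ((htail.const_mul r⁻¹).const_mul (K r ^ d)⁻¹).mul_const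
      ((r⁻¹ * ∫ u, F u) ^ (d - 1))
  obtain ⟨L, hL⟩ := (hlim.eventually (gt_mem_nhds hε)).exists
  refine ⟨L + r / 2, fun N X h y k hpos => ?_⟩
  -- Only the `k`-th factor is truncated. The local domination moves the argument by up to r/2, so a
  -- cutoff at `L + r / 2` for `ψ` becomes one at `L` for `Ψ`.
  have key := sum_invMass_mul_prod_le X hK hpos hr hKr
    (ψ := fun i v => if i = k then (if L + r / 2 < |v| then envelope K p v else 0)
      else envelope K p v)
    (Ψ := fun i => if i = k then {u : ℝ | L < |u|}.indicator F else F)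
    (fun i v => by split_ifs <;> first | exact envelope_nonneg hK p v | exact le_rfl)
    (fun i => by split_ifs; exacts [hi.indicator (hms L), hi]) ?_ y
  · refine le_trans (le_of_eq ?_) (key.trans (le_trans (le_of_eq ?_) hL.le))
    · refine Finset.sum_congr rfl fun n _ => ?_
      congr 1
      rw [← Finset.mul_prod_erase _ _ (Finset.mem_univ k), ← Finset.mul_prod_erase _ _
        (Finset.mem_univ k), if_pos rfl]
      have e : ∏ x ∈ Finset.univ.erase k, (if x = k then
          (if L + r / 2 < |(X n x - y x) / h x| then envelope K p ((X n x - y x) / h x) else 0)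
          else envelope K p ((X n x - y x) / h x))
          = ∏ x ∈ Finset.univ.erase k, envelope K p ((X n x - y x) / h x) :=
        Finset.prod_congr rfl fun i hi => by rw [if_neg (Finset.ne_of_mem_erase hi)]
      rw [e]
      split_ifs <;> simp
    · rw [← Finset.mul_prod_erase _ _ (Finset.mem_univ k), if_pos rfl, ← mul_assoc]
      congr 1
      rw [Finset.prod_congr rfl fun i hi => by rw [if_neg (Finset.ne_of_mem_erase hi)],
        Finset.prod_const, Finset.card_erase_of_mem (Finset.mem_univ k), Finset.card_univ,
        Fintype.card_fin]
  · intro i u v huv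
    have h1 := abs_sub_abs_le_abs_sub v u
    rw [abs_sub_comm] at h1
    by_cases hik : i = k
    · simp only [hik, if_true]
      split_ifs with hv
      · rw [Set.indicator_of_mem (by simp only [Set.mem_ofPred_eq]; linarith)]
        exact envelope_le hK huv
      · exact Set.indicator_nonneg (fun u _ => hF0 u) _
    · simp only [hik, if_false]
      exact envelope_le hK huv

/-- The inverse masses in a bounded region sum to at most a multiple of the inverse volume of a
bandwidth box. -/
lemma exists_sum_invMass_bounded_le (hK : IsSmoothingKernel K) (d : ℕ) (R : ℝ) :
    ∃ C, 0 ≤ C ∧ ∀ (N : ℕ) (X : Fin N → Fin d → ℝ) (h : Fin d → ℝ),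
      (∀ i, 0 < h i) → (∀ i, h i ≤ 1) →
        (∑ n, if ∀ i, |X n i| ≤ R then invMass K h X n else 0) * ∏ i, h i ≤ C := by
  obtain ⟨r, hr, hKr⟩ := hK.exists_pos
  -- In bandwidth units the region has half-width |R|/h_i, enlarged by r/2 for the covering.
  -- Multiplying the full width by h_i ≤ 1 leaves at most 2(|R| + r/2).
  refine ⟨(K r ^ d)⁻¹ * (r⁻¹ * (2 * (|R| + r / 2))) ^ d, by positivity, fun N X h hpos h1 => ?_⟩
  have key := sum_invMass_mul_prod_le X hK hpos hr hKr
    (ψ := fun i v => if |v| ≤ |R| / h i then 1 else 0)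
    (Ψ := fun i => (Set.Icc (-(|R| / h i + r / 2)) (|R| / h i + r / 2)).indicator fun _ => 1)
    (fun i v => by split_ifs <;> simp)
    (fun i => (integrable_indicator_iff measurableSet_Icc).2 (integrableOn_const (by simp)))
    (fun i u v huv => ?_) 0
  · have e1 : ∀ n, (if ∀ i, |X n i| ≤ R then invMass K h X n else 0) ≤ invMass K h X n *
        ∏ i, (if |(X n i - (0 : Fin d → ℝ) i) / h i| ≤ |R| / h i then (1 : ℝ) else 0) := by
      intro n
      split_ifs with hn
      · rw [Finset.prod_eq_one fun i _ => if_pos ?_, mul_one]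
        rw [Pi.zero_apply, sub_zero, abs_div, abs_of_pos (hpos i)]
        exact div_le_div_of_nonneg_right ((hn i).trans (le_abs_self R)) (hpos i).le
      · exact mul_nonneg (invMass_nonneg X hK n)
          (Finset.prod_nonneg fun i _ => by split_ifs <;> simp)
    have e2 := (Finset.sum_le_sum fun n (_ : n ∈ Finset.univ) => e1 n).trans key
    refine (mul_le_mul_of_nonneg_right e2 (Finset.prod_nonneg fun i _ => (hpos i).le)).trans ?_
    rw [mul_assoc, ← Finset.prod_mul_distrib, ← Fin.prod_const d (r⁻¹ * (2 * (|R| + r / 2)))]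
    refine mul_le_mul_of_nonneg_left (Finset.prod_le_prod (fun i _ => ?_) fun i _ => ?_)
      (by positivity)
    · refine mul_nonneg (mul_nonneg (by positivity) (integral_nonneg fun u =>
        Set.indicator_nonneg (fun _ _ => zero_le_one) _)) (hpos i).le
    · have hq : 0 ≤ |R| / h i + r / 2 :=
        add_nonneg (div_nonneg (abs_nonneg R) (hpos i).le) (by positivity)
      rw [integral_indicator measurableSet_Icc, setIntegral_const, smul_eq_mul, mul_one,
        Real.volume_real_Icc_of_le (by linarith), mul_assoc]
      refine mul_le_mul_of_nonneg_left ?_ (by positivity)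
      have e3 : (|R| / h i + r / 2 - -(|R| / h i + r / 2)) * h i
          = 2 * (|R| + r / 2 * h i) := by
        field_simp [(hpos i).ne']
        ring
      rw [e3]
      nlinarith [h1 i]
  · split_ifs with hv
    · rw [Set.indicator_of_mem]
      rw [Set.mem_Icc, ← abs_le]
      have := abs_sub_abs_le_abs_sub u v
      linarith
    · exact Set.indicator_nonneg (fun _ _ => zero_le_one) _

end Envelope

/-! ### Grids and closeness of measures on cells -/

/-- The index of the cell containing `y` in the grid of mesh `s` through the origin. -/
def cell {d : ℕ} (s y : Fin d → ℝ) : Fin d → ℤ := fun i => ⌊y i / s i⌋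

/-- The lower corner of the cell with index `c` in the grid of mesh `s`. -/
def corner {d : ℕ} (s : Fin d → ℝ) (c : Fin d → ℤ) : Fin d → ℝ := fun i => s i * c i

/-- Two measures are `Δ`-close in total variation on the grid of mesh `s`. -/
def CellClose {d : ℕ} (π₁ π₂ : Measure (Fin d → ℝ)) (s : Fin d → ℝ) (Δ : ℝ) : Prop :=
  ∀ φ : (Fin d → ℤ) → ℝ, (∀ c, |φ c| ≤ 1) →
    |∫ y, φ (cell s y) ∂π₁ - ∫ y, φ (cell s y) ∂π₂| ≤ Δ

section

variable {d : ℕ}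

lemma measurable_cell (s : Fin d → ℝ) : Measurable (cell s) :=
  measurable_pi_lambda _ fun i => Int.measurable_floor.comp (by fun_prop)

lemma measurable_comp_cell {E : Type*} [MeasurableSpace E] (φ : (Fin d → ℤ) → E) (s : Fin d → ℝ) :
    Measurable fun y => φ (cell s y) :=
  (measurable_of_countable φ).comp (measurable_cell s)

lemma abs_sub_corner_cell_le {s : Fin d → ℝ} (hs : ∀ i, 0 < s i) (y : Fin d → ℝ) (i : Fin d) :
    |y i - corner s (cell s y) i| ≤ s i := by
  have h1 := Int.floor_le (y i / s i)
  have h2 := Int.lt_floor_add_one (y i / s i)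
  rw [le_div_iff₀ (hs i)] at h1
  rw [div_lt_iff₀ (hs i)] at h2
  simp only [corner, cell]
  rw [abs_le]
  constructor <;> nlinarith [hs i]

lemma integrable_of_abs_le {α : Type*} [MeasurableSpace α] {π : Measure α} [IsFiniteMeasure π]
    {f : α → ℝ} (hf : Measurable f) {B : ℝ} (hB : ∀ x, |f x| ≤ B) : Integrable f π :=
  Integrable.of_bound hf.aestronglyMeasurable B (ae_of_all _ hB)

lemma CellClose.abs_sub_le {π₁ π₂ : Measure (Fin d → ℝ)} {s : Fin d → ℝ} {Δ : ℝ}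
    (hc : CellClose π₁ π₂ s Δ) {φ : (Fin d → ℤ) → ℝ} {B : ℝ} (hφ : ∀ c, |φ c| ≤ B) :
    |∫ y, φ (cell s y) ∂π₁ - ∫ y, φ (cell s y) ∂π₂| ≤ B * Δ := by
  have hB : 0 ≤ B := (abs_nonneg _).trans (hφ 0)
  rcases hB.eq_or_lt with rfl | hB
  · have : ∀ c, φ c = 0 := fun c => abs_nonpos_iff.1 (hφ c)
    simp [this]
  · have h1 := hc (fun c => φ c / B) fun c => by
      rw [abs_div, abs_of_pos hB]
      exact (div_le_one hB).2 (hφ c)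
    rw [integral_div, integral_div, ← sub_div, abs_div, abs_of_pos hB, div_le_iff₀' hB] at h1
    exact h1

end

/-! ### Oscillation of the product kernel and change of measure under smoothing -/

section Oscillation

variable {K : ℝ → ℝ} {d N : ℕ} {h : Fin d → ℝ}

/-- The excess volume of the product kernel widened by `s` over the one narrowed by `s`. -/
def oscVolume (K : ℝ → ℝ) (d : ℕ) (s : ℝ) : ℝ :=
  (∫ u, widen K s u) ^ d - (∫ u, narrow K s u) ^ d

lemma tendsto_oscVolume (hK : IsSmoothingKernel K) (d : ℕ) :
    Tendsto (oscVolume K d) (𝓝[≥] 0) (𝓝 0) := by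
  have := (hK.tendsto_integral_widen.pow d).sub (hK.tendsto_integral_narrow.pow d)
  rwa [one_pow, sub_self] at this

/-- A pointwise bound for the oscillation of the product kernel. -/
def oscKernel (K : ℝ → ℝ) (h : Fin d → ℝ) (s : ℝ) (x y : Fin d → ℝ) : ℝ :=
  ∏ i, widen K s ((x i - y i) / h i) - ∏ i, narrow K s ((x i - y i) / h i)

lemma measurable_prod_comp {k : ℝ → ℝ} (hk : Measurable k) (h x : Fin d → ℝ) :
    Measurable fun y : Fin d → ℝ => ∏ i, k ((x i - y i) / h i) :=
  Finset.measurable_prod _ fun i _ => hk.comp (by fun_prop)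

lemma measurable_prodKernel (hK : IsSmoothingKernel K) (h x : Fin d → ℝ) :
    Measurable (prodKernel K h x) :=
  measurable_prod_comp hK.measurable h x

lemma prodKernel_le_envelope (hK : IsSmoothingKernel K) (p : ℕ) (h x y : Fin d → ℝ) :
    prodKernel K h x y ≤ ∏ i, envelope K p ((x i - y i) / h i) :=
  Finset.prod_le_prod (fun _ _ => hK.nonneg _) fun _ _ => apply_le_envelope hK p _

lemma prodKernel_le (hK : IsSmoothingKernel K) (h x y : Fin d → ℝ) :
    prodKernel K h x y ≤ K 0 ^ d := by
  rw [← Fin.prod_const]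
  exact Finset.prod_le_prod (fun _ _ => hK.nonneg _) fun _ _ => hK.le_zero _

lemma integrable_prodKernel (hK : IsSmoothingKernel K) (h x : Fin d → ℝ)
    (π : Measure (Fin d → ℝ)) [IsFiniteMeasure π] : Integrable (prodKernel K h x) π :=
  integrable_of_abs_le (measurable_prodKernel hK h x) (B := K 0 ^ d) fun y => by
    rw [abs_of_nonneg (prodKernel_nonneg hK _ _)]
    exact prodKernel_le hK h x y

lemma measurable_oscKernel (hK : IsSmoothingKernel K) (s : ℝ) (h x : Fin d → ℝ) :
    Measurable (oscKernel K h s x) :=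
  (measurable_prod_comp (hK.measurable_widen s) h x).sub
    (measurable_prod_comp (hK.measurable_narrow s) h x)

lemma oscKernel_nonneg (hK : IsSmoothingKernel K) {s : ℝ} (hs : 0 ≤ s) (x y : Fin d → ℝ) :
    0 ≤ oscKernel K h s x y :=
  sub_nonneg.2 (Finset.prod_le_prod (fun _ _ => hK.narrow_nonneg _ _)
    fun _ _ => hK.narrow_le_widen hs _)

lemma oscKernel_le_envelope (hK : IsSmoothingKernel K) (p : ℕ) {s : ℝ} (hs : s ≤ 1)
    (x y : Fin d → ℝ) :
    oscKernel K h s x y ≤ ∏ i, envelope K p ((x i - y i) / h i) :=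
  (sub_le_self _ (Finset.prod_nonneg fun _ _ => hK.narrow_nonneg _ _)).trans
    (Finset.prod_le_prod (fun _ _ => hK.widen_nonneg _ _) fun _ _ => widen_le_envelope hK p hs _)

lemma abs_sub_div_le (hpos : ∀ i, 0 < h i) {s : ℝ} (x : Fin d → ℝ) {y z : Fin d → ℝ}
    (hyz : ∀ i, |y i - z i| ≤ s * h i) (i : Fin d) :
    |(x i - z i) / h i - (x i - y i) / h i| ≤ s := by
  rw [← sub_div, abs_div, abs_of_pos (hpos i), div_le_iff₀ (hpos i), sub_sub_sub_cancel_left]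
  exact hyz i

/-- Both values lie between the narrowed and the widened product centred at `z`. -/
lemma abs_prodKernel_sub_le (hK : IsSmoothingKernel K) (hpos : ∀ i, 0 < h i) {s : ℝ}
    (hs : 0 ≤ s) (x : Fin d → ℝ) {y z : Fin d → ℝ} (hyz : ∀ i, |y i - z i| ≤ s * h i) :
    |prodKernel K h x y - prodKernel K h x z| ≤ oscKernel K h s x z := by
  have h1 : prodKernel K h x y ≤ ∏ i, widen K s ((x i - z i) / h i) :=
    Finset.prod_le_prod (fun _ _ => hK.nonneg _) fun i _ =>
      hK.le_widen (abs_sub_div_le hpos x hyz i)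
  have h2 : ∏ i, narrow K s ((x i - z i) / h i) ≤ prodKernel K h x y :=
    Finset.prod_le_prod (fun _ _ => hK.narrow_nonneg _ _) fun i _ =>
      hK.narrow_le (abs_sub_div_le hpos x hyz i)
  have h3 : prodKernel K h x z ≤ ∏ i, widen K s ((x i - z i) / h i) :=
    Finset.prod_le_prod (fun _ _ => hK.nonneg _) fun i _ => hK.le_widen (by simpa)
  have h4 : ∏ i, narrow K s ((x i - z i) / h i) ≤ prodKernel K h x z :=
    Finset.prod_le_prod (fun _ _ => hK.narrow_nonneg _ _) fun i _ => hK.narrow_le (by simpa)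
  rw [oscKernel, abs_le]
  constructor <;> linarith

/-- Doubling the width pays for moving the base point. It replaces the oscillation at the corner of
a cell by a function of `y` itself, whose Lebesgue integral is explicit. -/
lemma oscKernel_le_oscKernel (hK : IsSmoothingKernel K) (hpos : ∀ i, 0 < h i) {s : ℝ}
    (hs : 0 ≤ s) (x : Fin d → ℝ) {y z : Fin d → ℝ} (hyz : ∀ i, |y i - z i| ≤ s * h i) :
    oscKernel K h s x z ≤ oscKernel K h (2 * s) x y := by
  have hzy : ∀ i, |(x i - y i) / h i - (x i - z i) / h i| ≤ 2 * s - s := fun i => by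
    rw [abs_sub_comm]
    linarith [abs_sub_div_le hpos x hyz i]
  refine sub_le_sub (Finset.prod_le_prod (fun _ _ => hK.widen_nonneg _ _) fun i _ => ?_)
    (Finset.prod_le_prod (fun _ _ => hK.narrow_nonneg _ _) fun i _ => ?_)
  · exact hK.widen_le_widen (hzy i)
  · exact hK.narrow_le_narrow hs (hzy i)

lemma integrable_prod_comp (hpos : ∀ i, 0 < h i) {k : ℝ → ℝ} (hk : Integrable k)
    (x : Fin d → ℝ) : Integrable fun y : Fin d → ℝ => ∏ i, k ((x i - y i) / h i) :=
  Integrable.fintype_prod (f := fun i t => k ((x i - t) / h i)) (μ := fun _ => volume)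
    fun i => (hk.comp_div (hpos i).ne').comp_sub_left (x i)

lemma integral_prod_comp (hpos : ∀ i, 0 < h i) (k : ℝ → ℝ) (x : Fin d → ℝ) :
    ∫ y : Fin d → ℝ, ∏ i, k ((x i - y i) / h i) = (∏ i, h i) * (∫ u, k u) ^ d := by
  rw [integral_fintype_prod_volume_eq_prod (f := fun i t => k ((x i - t) / h i)),
    ← Fin.prod_const, ← Finset.prod_mul_distrib]
  refine Finset.prod_congr rfl fun i _ => ?_
  rw [integral_sub_left_eq_self (fun t => k (t / h i)) volume (x i), Measure.integral_comp_div,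
    smul_eq_mul, abs_of_pos (hpos i)]

lemma integrable_oscKernel (hK : IsSmoothingKernel K) (hpos : ∀ i, 0 < h i) {s : ℝ}
    (hs : 0 ≤ s) (x : Fin d → ℝ) : Integrable (oscKernel K h s x) :=
  (integrable_prod_comp hpos (hK.integrable_widen hs) x).sub
    (integrable_prod_comp hpos (hK.integrable_narrow hs) x)

lemma integral_oscKernel (hK : IsSmoothingKernel K) (hpos : ∀ i, 0 < h i) {s : ℝ}
    (hs : 0 ≤ s) (x : Fin d → ℝ) :
    ∫ y, oscKernel K h s x y = (∏ i, h i) * oscVolume K d s := by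
  simp only [oscKernel]
  rw [integral_sub (integrable_prod_comp hpos (hK.integrable_widen hs) x)
    (integrable_prod_comp hpos (hK.integrable_narrow hs) x), integral_prod_comp hpos,
    integral_prod_comp hpos, ← mul_sub, oscVolume]

lemma oscVolume_nonneg (hK : IsSmoothingKernel K) (d : ℕ) {s : ℝ} (hs : 0 ≤ s) :
    0 ≤ oscVolume K d s :=
  sub_nonneg.2 (pow_le_pow_left₀ (integral_nonneg fun u => hK.narrow_nonneg s u)
    (integral_mono (hK.integrable_narrow hs) (hK.integrable_widen hs)
      fun u => hK.narrow_le_widen hs u) d)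

/-- Two measures which are close on the grid of mesh `δ h` have close kernel smoothings, in the
mean with respect to the inverse masses, when one of them is nearly dominated by a multiple of
Lebesgue measure. -/
lemma abs_sum_invMass_mul_sub_le (hK : IsSmoothingKernel K) {p : ℕ} (X : Fin N → Fin d → ℝ)
    (hpos : ∀ i, 0 < h i) {g : (Fin d → ℝ) → ℝ} {G R : ℝ} (hG : ∀ x, |g x| ≤ G)
    (hR : ∀ x, g x ≠ 0 → ∀ i, |x i| ≤ R) {ρ C : ℝ}
    (hρ : ∀ y : Fin d → ℝ, ∑ n, invMass K h X n * ∏ i, envelope K p ((X n i - y i) / h i) ≤ ρ)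
    (hC : (∑ n, if ∀ i, |X n i| ≤ R then invMass K h X n else 0) * ∏ i, h i ≤ C)
    {δ : ℝ} (hδ : 0 < δ) (hδ1 : 2 * δ ≤ 1) {π₁ π₂ : Measure (Fin d → ℝ)}
    [IsProbabilityMeasure π₁] [IsProbabilityMeasure π₂] {Δ : ℝ}
    (hclose : CellClose π₁ π₂ (fun i => δ * h i) Δ) {M ε : ℝ} (hM0 : 0 ≤ M)
    (hM : ∀ φ : (Fin d → ℝ) → ℝ, Measurable φ → (∀ y, 0 ≤ φ y) → (∀ y, φ y ≤ ρ) →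
      Integrable φ → ∫ y, φ y ∂π₂ ≤ M * (∫ y, φ y) + ρ * ε) :
    |∑ n, invMass K h X n * g (X n) *
        (∫ y, prodKernel K h (X n) y ∂π₁ - ∫ y, prodKernel K h (X n) y ∂π₂)|
      ≤ G * (2 * ρ * Δ + 2 * (M * (C * oscVolume K d (2 * δ)) + ρ * ε)) := by
  classical
  have hG0 : 0 ≤ G := (abs_nonneg _).trans (hG 0)
  have hs : ∀ i, 0 < δ * h i := fun i => mul_pos hδ (hpos i)
  set s : Fin d → ℝ := fun i => δ * h i with hsdef
  -- After exchanging sum and integral, the quantity to bound is ∫ τ dπ₁ - ∫ τ dπ₂. Here `τ` is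
  -- bounded by G ρ, and its deviation from its value at the corner of the cell is at most `G * E δ`
  -- there; `b` keeps only the sample points where `g` may be nonzero.
  set τ : (Fin d → ℝ) → ℝ := fun y => ∑ n, invMass K h X n * g (X n) * prodKernel K h (X n) y
    with hτ
  set b : Fin N → ℝ := fun n => if ∀ i, |X n i| ≤ R then invMass K h X n else 0 with hb
  set E : ℝ → (Fin d → ℝ) → ℝ := fun t y => ∑ n, b n * oscKernel K h t (X n) y with hE
  have hq := invMass_nonneg (h := h) X hK
  have hb0 : ∀ n, 0 ≤ b n := fun n => by
    simp only [hb]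
    split_ifs
    exacts [hq n, le_rfl]
  have hbq : ∀ n, b n ≤ invMass K h X n := fun n => by
    simp only [hb]
    split_ifs
    exacts [le_rfl, hq n]
  have hgb : ∀ n, invMass K h X n * |g (X n)| ≤ G * b n := fun n => by
    simp only [hb]
    split_ifs with hn
    · rw [mul_comm]
      exact mul_le_mul_of_nonneg_right (hG _) (hq n)
    · have : g (X n) = 0 := by
        by_contra h0
        exact hn (hR _ h0)
      simp [this]
  have hτm : Measurable τ := Finset.measurable_sum _ fun n _ =>
    (measurable_prodKernel hK h (X n)).const_mul _
  have hEm : ∀ t, Measurable (E t) := fun t => Finset.measurable_sum _ fun n _ =>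
    (measurable_oscKernel hK t h (X n)).const_mul _
  have hE0 : ∀ t, 0 ≤ t → ∀ y, 0 ≤ E t y := fun t ht y =>
    Finset.sum_nonneg fun n _ => mul_nonneg (hb0 n) (oscKernel_nonneg hK ht _ _)
  have hEρ : ∀ t, 0 ≤ t → t ≤ 1 → ∀ y, E t y ≤ ρ := fun t ht0 ht y =>
    (Finset.sum_le_sum fun n _ => mul_le_mul (hbq n) (oscKernel_le_envelope hK p ht _ _)
      (oscKernel_nonneg hK ht0 _ _) (hq n)).trans (hρ y)
  have hEabs : ∀ t, 0 ≤ t → t ≤ 1 → ∀ y, |E t y| ≤ ρ := fun t ht0 ht y => by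
    rw [abs_of_nonneg (hE0 t ht0 y)]
    exact hEρ t ht0 ht y
  have hτb : ∀ y, |τ y| ≤ G * ρ := fun y => by
    refine (Finset.abs_sum_le_sum_abs _ _).trans ?_
    refine le_trans ?_ (mul_le_mul_of_nonneg_left (hρ y) hG0)
    rw [Finset.mul_sum]
    refine Finset.sum_le_sum fun n _ => ?_
    rw [abs_mul, abs_mul, abs_of_nonneg (hq n), abs_of_nonneg (prodKernel_nonneg hK _ _),
      mul_comm (invMass K h X n), mul_assoc]
    exact mul_le_mul (hG _) (mul_le_mul_of_nonneg_left (prodKernel_le_envelope hK p _ _ _) (hq n))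
      (mul_nonneg (hq n) (prodKernel_nonneg hK _ _)) hG0
  have hosc : ∀ y, |τ y - τ (corner s (cell s y))| ≤ G * E δ (corner s (cell s y)) := fun y => by
    rw [hτ]
    simp only
    rw [← Finset.sum_sub_distrib]
    refine (Finset.abs_sum_le_sum_abs _ _).trans ?_
    rw [hE]
    simp only
    rw [Finset.mul_sum]
    refine Finset.sum_le_sum fun n _ => ?_
    rw [← mul_sub, abs_mul, abs_mul, abs_of_nonneg (hq n), ← mul_assoc]
    exact mul_le_mul (hgb n) (abs_prodKernel_sub_le hK hpos hδ.le _
      fun i => abs_sub_corner_cell_le hs y i) (abs_nonneg _) (mul_nonneg hG0 (hb0 n))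
  have hE2 : ∀ y, E δ (corner s (cell s y)) ≤ E (2 * δ) y := fun y =>
    Finset.sum_le_sum fun n _ => mul_le_mul_of_nonneg_left
      (oscKernel_le_oscKernel hK hpos hδ.le _ fun i => abs_sub_corner_cell_le hs y i) (hb0 n)
  have hτcm : Measurable fun y => τ (corner s (cell s y)) :=
    measurable_comp_cell (fun c => τ (corner s c)) s
  have hEcm : Measurable fun y => E δ (corner s (cell s y)) :=
    measurable_comp_cell (fun c => E δ (corner s c)) s
  have hE2i : Integrable (E (2 * δ)) := integrable_finsetSum _ fun n _ =>
    (integrable_oscKernel hK hpos (by positivity) _).const_mul _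
  have hE2v : ∫ y, E (2 * δ) y ≤ C * oscVolume K d (2 * δ) := by
    simp only [hE]
    rw [integral_finsetSum _ fun n _ =>
      (integrable_oscKernel hK hpos (by positivity) _).const_mul _]
    simp_rw [integral_const_mul, integral_oscKernel hK hpos (by positivity : 0 ≤ 2 * δ)]
    rw [← Finset.sum_mul, ← mul_assoc]
    exact mul_le_mul_of_nonneg_right hC (oscVolume_nonneg hK d (by positivity))
  have hEc2 : ∫ y, E δ (corner s (cell s y)) ∂π₂ ≤ M * (C * oscVolume K d (2 * δ)) + ρ * ε := by
    calc ∫ y, E δ (corner s (cell s y)) ∂π₂ ≤ ∫ y, E (2 * δ) y ∂π₂ :=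
          integral_mono (integrable_of_abs_le hEcm fun y => hEabs δ hδ.le (by linarith) _)
            (integrable_of_abs_le (hEm _) (hEabs _ (by positivity) hδ1)) hE2
      _ ≤ M * (∫ y, E (2 * δ) y) + ρ * ε :=
          hM _ (hEm _) (hE0 _ (by positivity)) (hEρ _ (by positivity) hδ1) hE2i
      _ ≤ _ := by linarith [mul_le_mul_of_nonneg_left hE2v hM0]
  -- Only `π₂` is nearly dominated by Lebesgue measure. The bound passes to `π₁` by closeness,
  -- because the oscillation at the corner depends on the cell alone.
  have hEc1 : ∫ y, E δ (corner s (cell s y)) ∂π₁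
      ≤ M * (C * oscVolume K d (2 * δ)) + ρ * ε + ρ * Δ := by
    have := (abs_le.1 (hclose.abs_sub_le (φ := fun c => E δ (corner s c)) fun c =>
      hEabs δ hδ.le (by linarith) _)).2
    linarith
  have hmain := hclose.abs_sub_le (φ := fun c => τ (corner s c)) fun c => hτb _
  have hsplit : ∀ π : Measure (Fin d → ℝ), IsProbabilityMeasure π →
      |∫ y, τ y ∂π - ∫ y, τ (corner s (cell s y)) ∂π|
        ≤ G * ∫ y, E δ (corner s (cell s y)) ∂π := by
    intro π _
    rw [← integral_sub (integrable_of_abs_le hτm hτb)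
      (integrable_of_abs_le hτcm fun y => hτb _), ← integral_const_mul]
    refine (abs_integral_le_integral_abs).trans (integral_mono ?_ ?_ hosc)
    · exact ((integrable_of_abs_le hτm hτb).sub (integrable_of_abs_le hτcm fun y => hτb _)).abs
    · exact (integrable_of_abs_le hEcm fun y => hEabs δ hδ.le (by linarith) _).const_mul _
  have hint : ∀ π : Measure (Fin d → ℝ), IsProbabilityMeasure π →
      ∑ n, invMass K h X n * g (X n) * ∫ y, prodKernel K h (X n) y ∂π = ∫ y, τ y ∂π := by
    intro π _
    simp only [hτ]
    rw [integral_finsetSum]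
    · simp_rw [integral_const_mul]
    · exact fun n _ => (integrable_prodKernel hK h (X n) π).const_mul _
  simp_rw [mul_sub]
  rw [Finset.sum_sub_distrib, hint π₁ inferInstance, hint π₂ inferInstance]
  have h1 := hsplit π₁ inferInstance
  have h2 := hsplit π₂ inferInstance
  have h3 := mul_le_mul_of_nonneg_left hEc1 hG0
  have h4 := mul_le_mul_of_nonneg_left hEc2 hG0
  rw [abs_le] at h1 h2 hmain ⊢
  constructor <;> linarith [h1.1, h1.2, h2.1, h2.2, hmain.1, hmain.2]

end Oscillation

/-! ### Empirical measures and products of close marginals -/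

open scoped ENNReal

/-- The empirical measure of a finite sample. -/
def empirical {E : Type*} [MeasurableSpace E] {N : ℕ} (X : Fin N → E) : Measure E :=
  (N : ℝ≥0∞)⁻¹ • ∑ n, Measure.dirac (X n)

section Empirical

variable {E : Type*} [MeasurableSpace E] {N : ℕ} (X : Fin N → E)

lemma integral_empirical [MeasurableSingletonClass E] (f : E → ℝ) :
    ∫ x, f x ∂(empirical X) = (∑ n, f (X n)) / N := by
  rw [empirical, integral_smul_measure, integral_finsetSum_measure fun n _ => integrable_dirac (by simp)]
  simp [div_eq_inv_mul]

instance isProbabilityMeasure_empirical [NeZero N] : IsProbabilityMeasure (empirical X) := by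
  constructor
  have h0 : (N : ℝ≥0∞) ≠ 0 := by exact_mod_cast NeZero.ne N
  simp [empirical, ENNReal.inv_mul_cancel h0 (ENNReal.natCast_ne_top N)]

end Empirical

section Pi

variable {d : ℕ}

/-- Changing one marginal amounts to resampling that coordinate independently, which reduces a
comparison of product measures to Fubini in a single variable. -/
lemma pi_update_eq_map (m : Fin d → Measure ℝ) [∀ i, IsProbabilityMeasure (m i)] (i : Fin d)
    (ρ : Measure ℝ) [IsProbabilityMeasure ρ] :
    Measure.pi (Function.update m i ρ)
      = ((Measure.pi m).prod ρ).map fun q => Function.update q.1 i q.2 := by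
  have : ∀ j, IsProbabilityMeasure (Function.update m i ρ j) := fun j => by
    rcases eq_or_ne j i with rfl | hj
    · simpa
    · simp only [Function.update_of_ne hj]
      infer_instance
  refine Measure.pi_eq fun s hs => ?_
  rw [Measure.map_apply measurable_update' (MeasurableSet.univ_pi hs)]
  have e : (fun q : (Fin d → ℝ) × ℝ => Function.update q.1 i q.2) ⁻¹' Set.univ.pi s
      = (Set.univ.pi (Function.update s i Set.univ)) ×ˢ s i := by
    ext q
    simp only [Set.mem_preimage, Set.mem_univ_pi, Set.mem_prod]
    constructor
    · refine fun H => ⟨fun j => ?_, by simpa using H i⟩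
      rcases eq_or_ne j i with rfl | hj
      · simp
      · simpa [Function.update_of_ne hj] using H j
    · rintro ⟨H1, H2⟩ j
      rcases eq_or_ne j i with rfl | hj
      · simpa
      · simpa [Function.update_of_ne hj] using H1 j
  rw [e, Measure.prod_prod, Measure.pi_pi, ← Finset.mul_prod_erase _ _ (Finset.mem_univ i),
    ← Finset.mul_prod_erase _ _ (Finset.mem_univ i)]
  simp only [Function.update_self, measure_univ, one_mul]
  rw [mul_comm]
  congr 1
  refine Finset.prod_congr rfl fun j hj => ?_
  rw [Function.update_of_ne (Finset.ne_of_mem_erase hj),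
    Function.update_of_ne (Finset.ne_of_mem_erase hj)]

lemma integral_pi_update (m : Fin d → Measure ℝ) [∀ i, IsProbabilityMeasure (m i)] (i : Fin d)
    (ρ : Measure ℝ) [IsProbabilityMeasure ρ] {F : (Fin d → ℝ) → ℝ} (hF : Measurable F) {B : ℝ}
    (hB : ∀ y, |F y| ≤ B) :
    ∫ y, F y ∂(Measure.pi (Function.update m i ρ))
      = ∫ y, ∫ t, F (Function.update y i t) ∂ρ ∂(Measure.pi m) := by
  rw [pi_update_eq_map, integral_map measurable_update'.aemeasurable hF.aestronglyMeasurable]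
  exact integral_prod _ (integrable_of_abs_le (hF.comp measurable_update') fun q => hB _)

lemma cell_update (s y : Fin d → ℝ) (i : Fin d) (t : ℝ) :
    cell s (Function.update y i t) = Function.update (cell s y) i ⌊t / s i⌋ := by
  ext j
  rcases eq_or_ne j i with rfl | hj
  · simp [cell]
  · simp [cell, Function.update_of_ne hj]

/-- Products of measures with close marginals are close on the product grid. -/
lemma CellClose.pi {m m' : Fin d → Measure ℝ} [∀ i, IsProbabilityMeasure (m i)]
    [∀ i, IsProbabilityMeasure (m' i)] {s : Fin d → ℝ} {Δ : ℝ}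
    (hm : ∀ i, ∀ φ : ℤ → ℝ, (∀ c, |φ c| ≤ 1) →
      |∫ t, φ ⌊t / s i⌋ ∂(m i) - ∫ t, φ ⌊t / s i⌋ ∂(m' i)| ≤ Δ) :
    CellClose (Measure.pi m) (Measure.pi m') s (d * Δ) := by
  classical
  intro φ hφ
  -- Hybrid argument: marginals are exchanged one at a time. With the other coordinates fixed, the
  -- integrand depends on one cell index only, so each exchange costs `Δ`.
  let hyb : Finset (Fin d) → Fin d → Measure ℝ := fun S i => if i ∈ S then m' i else m i
  have hprob : ∀ S i, IsProbabilityMeasure (hyb S i) := fun S i => by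
    simp only [hyb]
    split_ifs <;> infer_instance
  have hφm : Measurable fun y => φ (cell s y) := measurable_comp_cell φ s
  have key : ∀ S : Finset (Fin d), |∫ y, φ (cell s y) ∂(Measure.pi m)
      - ∫ y, φ (cell s y) ∂(Measure.pi (hyb S))| ≤ S.card * Δ := by
    intro S
    induction S using Finset.induction_on with
    | empty => simp [hyb]
    | insert i S hi ih =>
      have e1 : hyb (insert i S) = Function.update (hyb S) i (m' i) := by
        ext1 j
        rcases eq_or_ne j i with rfl | hj
        · simp [hyb]
        · simp [hyb, Finset.mem_insert, hj]
      have e2 : hyb S = Function.update (hyb S) i (m i) := by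
        ext1 j
        rcases eq_or_ne j i with rfl | hj
        · simp [hyb, hi]
        · simp [Function.update_of_ne hj]
      have hb : ∀ y, |φ (cell s y)| ≤ 1 := fun y => hφ _
      have i1 := integral_pi_update (hyb S) i (m i) hφm hb
      have i2 := integral_pi_update (hyb S) i (m' i) hφm hb
      rw [← e2] at i1
      rw [← e1] at i2
      have hu : Measurable fun q : (Fin d → ℝ) × ℝ => φ (cell s (Function.update q.1 i q.2)) :=
        hφm.comp measurable_update'
      have hint : ∀ ρ : Measure ℝ, IsProbabilityMeasure ρ →
          Integrable (fun y => ∫ t, φ (cell s (Function.update y i t)) ∂ρ)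
            (Measure.pi (hyb S)) := fun ρ _ =>
        (integrable_of_abs_le (π := (Measure.pi (hyb S)).prod ρ) hu fun q => hφ _).integral_prod_left
      have step : |∫ y, φ (cell s y) ∂(Measure.pi (hyb S))
          - ∫ y, φ (cell s y) ∂(Measure.pi (hyb (insert i S)))| ≤ Δ := by
        rw [i1, i2, ← integral_sub (hint _ inferInstance) (hint _ inferInstance)]
        have hle := norm_integral_le_of_norm_le_const (μ := Measure.pi (hyb S)) (C := Δ)
          (f := fun y => ∫ t, φ (cell s (Function.update y i t)) ∂(m i)
            - ∫ t, φ (cell s (Function.update y i t)) ∂(m' i)) (ae_of_all _ fun y => ?_)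
        · simpa using hle
        simp only [cell_update]
        exact hm i (fun c => φ (Function.update (cell s y) i c)) fun c => hφ _
      have := _root_.abs_sub_le (∫ y, φ (cell s y) ∂(Measure.pi m))
        (∫ y, φ (cell s y) ∂(Measure.pi (hyb S)))
        (∫ y, φ (cell s y) ∂(Measure.pi (hyb (insert i S))))
      rw [Finset.card_insert_of_notMem hi]
      push_cast
      linarith
  simpa [hyb] using key Finset.univ

/-- The empirical marginals inherit closeness from the joint empirical measure. -/
lemma CellClose.pi_empirical {N : ℕ} [NeZero N] {X : Fin N → Fin d → ℝ}
    {π : Measure (Fin d → ℝ)} [IsProbabilityMeasure π] {s : Fin d → ℝ} {Δ : ℝ}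
    (hc : CellClose (empirical X) π s Δ) :
    CellClose (Measure.pi fun i => empirical fun n => X n i)
      (Measure.pi fun i => π.map fun y => y i) s (d * Δ) := by
  have : ∀ i, IsProbabilityMeasure (π.map fun y : Fin d → ℝ => y i) := fun i =>
    Measure.isProbabilityMeasure_map (measurable_pi_apply i).aemeasurable
  refine CellClose.pi fun i φ hφ => ?_
  have h1 := hc (fun c => φ (c i)) fun c => hφ _
  rw [integral_empirical] at h1 ⊢
  rwa [integral_map (measurable_pi_apply i).aemeasurable]
  exact ((measurable_of_countable φ).comp
    (Int.measurable_floor.comp (by fun_prop))).aestronglyMeasurable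

end Pi

/-! ### Limits of the smoothing errors -/

section Limits

variable {d : ℕ}

/-- An absolutely continuous finite measure is dominated by a multiple of the reference measure up
to a small error. -/
lemma exists_integral_le_mul_add {α : Type*} [MeasurableSpace α] {ν π : Measure α} [SigmaFinite ν]
    [IsFiniteMeasure π] (hπ : π ≪ ν) {ε : ℝ} (hε : 0 < ε) :
    ∃ M, 0 ≤ M ∧ ∀ (φ : α → ℝ) (B : ℝ), 0 ≤ B → Measurable φ → (∀ y, 0 ≤ φ y) → (∀ y, φ y ≤ B) →
      Integrable φ ν → ∫ y, φ y ∂π ≤ M * (∫ y, φ y ∂ν) + B * ε := by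
  set f : α → ℝ := fun x => (π.rnDeriv ν x).toReal with hf
  have hfm : Measurable f := (Measure.measurable_rnDeriv π ν).ennreal_toReal
  have hfi : Integrable f ν := Measure.integrable_toReal_rnDeriv
  have hf0 : ∀ x, 0 ≤ f x := fun x => ENNReal.toReal_nonneg
  have hms : ∀ M : ℝ, MeasurableSet {x | M < f x} := fun M => measurableSet_lt measurable_const hfm
  have htail : Tendsto (fun M : ℝ => ∫ x, {x | M < f x}.indicator f x ∂ν) atTop (𝓝 0) := by
    rw [← integral_zero α ℝ]
    refine tendsto_integral_filter_of_dominated_convergence f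
      (Eventually.of_forall fun L => (hfi.indicator (hms L)).aestronglyMeasurable)
      (Eventually.of_forall fun L => ae_of_all _ fun u => ?_) hfi (ae_of_all _ fun u => ?_)
    · rw [Real.norm_of_nonneg (Set.indicator_nonneg (fun u _ => hf0 u) _)]
      exact Set.indicator_le_self' (fun u _ => hf0 u) _
    · refine tendsto_const_nhds.congr' ?_
      filter_upwards [eventually_ge_atTop (f u)] with L hL
      rw [Set.indicator_of_notMem (by simpa using hL)]
  -- `M` is a truncation level for the density: the part of `π` where the density exceeds `M` has
  -- mass less than `ε`.
  obtain ⟨M, hM, hM0⟩ := ((htail.eventually (gt_mem_nhds hε)).and (eventually_ge_atTop 0)).exists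
  refine ⟨M, hM0, fun φ B hB hφm hφ0 hφB hφi => ?_⟩
  rw [← integral_rnDeriv_smul hπ]
  calc ∫ x, (π.rnDeriv ν x).toReal • φ x ∂ν
      ≤ ∫ x, (M * φ x + B * {x | M < f x}.indicator f x) ∂ν := by
        refine integral_mono_of_nonneg (ae_of_all _ fun x => mul_nonneg (hf0 x) (hφ0 x))
          ((hφi.const_mul _).add ((hfi.indicator (hms M)).const_mul _)) (ae_of_all _ fun x => ?_)
        change f x * φ x ≤ M * φ x + B * {x | M < f x}.indicator f x
        by_cases hx : M < f x
        · rw [Set.indicator_of_mem (by exact hx)]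
          nlinarith [hφ0 x, hφB x, hf0 x]
        · rw [Set.indicator_of_notMem (by exact hx)]
          nlinarith [hφ0 x, hφB x, hf0 x, not_lt.1 hx]
    _ = M * (∫ y, φ y ∂ν) + B * ∫ x, {x | M < f x}.indicator f x ∂ν := by
        rw [integral_add (hφi.const_mul _) ((hfi.indicator (hms M)).const_mul _),
          integral_const_mul, integral_const_mul]
    _ ≤ _ := by
        have := mul_le_mul_of_nonneg_left hM.le hB
        linarith

variable {K : ℝ → ℝ} {h : ℕ → Fin d → ℝ} {z : ℕ → Fin d → ℝ}

/-- The measures `π₁ N` merge with `π₂` on all grids of mesh proportional to the bandwidths. -/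
def Merge (h : ℕ → Fin d → ℝ) (π₁ : ℕ → Measure (Fin d → ℝ)) (π₂ : Measure (Fin d → ℝ)) : Prop :=
  ∀ k : ℕ, ∀ ε > 0, ∀ᶠ N in atTop, CellClose (π₁ N) π₂ (fun i => ((k : ℝ) + 1)⁻¹ * h N i) ε

/-- The order of choices matters: `ε` fixes the domination constant `M`, then the mesh 1/(k+1) is
taken fine enough for the oscillation volume times `M` to be small, and only then is `N` large.
Compact support of `g` bounds the inverse masses that enter. -/
lemma tendsto_sum_invMass_mul_sub (hK : IsSmoothingKernel K) (hpos : ∀ N i, 0 < h N i)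
    (hzero : ∀ i, Tendsto (fun N => h N i) atTop (𝓝 0)) {π₁ : ℕ → Measure (Fin d → ℝ)}
    {π₂ : Measure (Fin d → ℝ)} (h₁ : ∀ᶠ N in atTop, IsProbabilityMeasure (π₁ N))
    [IsProbabilityMeasure π₂] (hac : π₂ ≪ volume) (hm : Merge h π₁ π₂)
    {g : (Fin d → ℝ) → ℝ} (hg : Continuous g) (hgs : HasCompactSupport g) :
    Tendsto (fun N => ∑ n, invMass K (h N) (sample z N) n * g (z n) *
      (∫ y, prodKernel K (h N) (z n) y ∂(π₁ N) - ∫ y, prodKernel K (h N) (z n) y ∂π₂))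
      atTop (𝓝 0) := by
  have hp : Integrable fun u => |u| ^ 0 * K u := by simpa using hK.integrable
  obtain ⟨G, hG⟩ := hgs.exists_bound_of_continuous hg
  obtain ⟨R, hR⟩ := hgs.isCompact.isBounded.exists_norm_le
  have hR' : ∀ x, g x ≠ 0 → ∀ i, |x i| ≤ R := fun x hx i =>
    (norm_le_pi_norm x i).trans (hR x (subset_tsupport g hx))
  obtain ⟨ρ, hρ0, hρ⟩ := exists_sum_envelope_le hK hp d
  obtain ⟨C, hC0, hC⟩ := exists_sum_invMass_bounded_le hK d R
  have hG0 : 0 ≤ G := (norm_nonneg _).trans (hG 0)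
  rw [Metric.tendsto_nhds]
  intro e he
  simp only [dist_zero_right, Real.norm_eq_abs]
  -- The closeness and domination errors add up to 4 G ρ ε ≤ e/2; the oscillation gets e/4. The +1
  -- avoids a zero denominator.
  set ε := e / (8 * (G * ρ + 1)) with hεdef
  have hGρ : 0 ≤ G * ρ := mul_nonneg hG0 hρ0
  have hε : 0 < ε := by positivity
  have hεe : G * ρ * ε ≤ e / 8 := by
    rw [hεdef, mul_div_assoc', div_le_div_iff₀ (by positivity) (by norm_num)]
    nlinarith
  obtain ⟨M, hM0, hM⟩ := exists_integral_le_mul_add hac hε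
  have hδ : Tendsto (fun k : ℕ => 2 * ((k : ℝ) + 1)⁻¹) atTop (𝓝 0) := by
    simpa using (tendsto_one_div_add_atTop_nhds_zero_nat (𝕜 := ℝ)).const_mul 2
  have hδ' : Tendsto (fun k : ℕ => 2 * ((k : ℝ) + 1)⁻¹) atTop (𝓝[≥] 0) :=
    tendsto_nhdsWithin_iff.2 ⟨hδ, Eventually.of_forall fun k => by simp; positivity⟩
  have hosc : Tendsto (fun k : ℕ => G * (2 * (M * (C * oscVolume K d (2 * ((k : ℝ) + 1)⁻¹)))))
      atTop (𝓝 0) := by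
    simpa using ((((tendsto_oscVolume hK d).comp hδ').const_mul C).const_mul M
      |>.const_mul 2).const_mul G
  obtain ⟨k, hk1, hk2⟩ := ((hosc.eventually (gt_mem_nhds (by positivity : 0 < e / 4))).and
    (hδ.eventually (gt_mem_nhds one_pos))).exists
  have hle1 : ∀ᶠ N in atTop, ∀ i, h N i ≤ 1 := eventually_all.2 fun i =>
    ((hzero i).eventually (gt_mem_nhds one_pos)).mono fun N hN => hN.le
  filter_upwards [h₁, hm k ε hε, hle1] with N hN1 hN2 hN3
  have key := abs_sum_invMass_mul_sub_le hK (p := 0) (sample z N) (hpos N) hG hR'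
    (fun y => hρ N _ _ y (hpos N)) (hC N _ _ (hpos N) hN3) (δ := ((k : ℝ) + 1)⁻¹) (by positivity)
    hk2.le hN2 hM0 (fun φ h1 h2 h3 h4 => hM φ ρ hρ0 h1 h2 h3 h4)
  refine key.trans_lt ?_
  nlinarith

/-- A continuous factor may be moved through the kernel smoothing. -/
lemma tendsto_sum_invMass_mul_integral_mul_sub (hK : IsSmoothingKernel K)
    (hpos : ∀ N i, 0 < h N i) (hzero : ∀ i, Tendsto (fun N => h N i) atTop (𝓝 0))
    {π : Measure (Fin d → ℝ)} [IsProbabilityMeasure π] {g q : (Fin d → ℝ) → ℝ} {G : ℝ}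
    (hG : ∀ x, |g x| ≤ G) (hq : Continuous q) (hqs : HasCompactSupport q) :
    Tendsto (fun N => ∑ n, invMass K (h N) (sample z N) n * g (z n) *
      (∫ y, prodKernel K (h N) (z n) y * q y ∂π - q (z n) * ∫ y, prodKernel K (h N) (z n) y ∂π))
      atTop (𝓝 0) := by
  have hp : Integrable fun u => |u| ^ 0 * K u := by simpa using hK.integrable
  have hG0 : 0 ≤ G := (abs_nonneg _).trans (hG 0)
  obtain ⟨Q, hQ⟩ := hqs.exists_bound_of_continuous hq
  have hQ0 : 0 ≤ Q := (norm_nonneg _).trans (hQ 0)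
  obtain ⟨ρ, hρ0, hρ⟩ := exists_sum_envelope_le hK hp d
  have hqu := hqs.uniformContinuous_of_continuous hq
  rw [Metric.tendsto_nhds]
  intro e he
  simp only [dist_zero_right, Real.norm_eq_abs]
  set ε := e / (2 * (G * (ρ + 2 * Q * d) + 1)) with hεdef
  have hD : 0 ≤ G * (ρ + 2 * Q * d) := by positivity
  have hε : 0 < ε := by positivity
  have hεe : G * (ρ + 2 * Q * d) * ε < e := by
    rw [hεdef, mul_div_assoc', div_lt_iff₀ (by positivity)]
    nlinarith
  obtain ⟨η, hη, hη'⟩ := Metric.uniformContinuous_iff.1 hqu ε hε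
  obtain ⟨L, hL⟩ := exists_sum_envelope_tail_le hK hp d hε
  have hLh : ∀ᶠ N in atTop, ∀ i, L * h N i < η / 2 := eventually_all.2 fun i => by
    have : Tendsto (fun N => L * h N i) atTop (𝓝 0) := by simpa using (hzero i).const_mul L
    exact this.eventually (gt_mem_nhds (by positivity))
  filter_upwards [hLh] with N hN
  have hq0 := invMass_nonneg (h := h N) (sample z N) hK
  -- Either all coordinates of x - y are within `L` bandwidths, where uniform continuity gives an
  -- increment of at most `ε`, or some coordinate is not, and the crude increment 2Q is multiplied
  -- by the tail of the envelopes.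
  have hpt : ∀ (x y : Fin d → ℝ), prodKernel K (h N) x y * |q y - q x|
      ≤ ε * (∏ i, envelope K 0 ((x i - y i) / h N i)) + 2 * Q * ∑ k,
        if L < |(x k - y k) / h N k| then ∏ i, envelope K 0 ((x i - y i) / h N i) else 0 := by
    intro x y
    have hk0 := prodKernel_nonneg (h := h N) hK x y
    have hke := prodKernel_le_envelope hK 0 (h N) x y
    have hs0 : ∀ k : Fin d, 0 ≤ if L < |(x k - y k) / h N k| then
        ∏ i, envelope K 0 ((x i - y i) / h N i) else 0 := fun k => by
      split_ifs
      exacts [hk0.trans hke, le_rfl]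
    by_cases hxy : ∃ k, L < |(x k - y k) / h N k|
    · obtain ⟨k, hk⟩ := hxy
      have h1 : ∏ i, envelope K 0 ((x i - y i) / h N i) ≤ ∑ k,
          if L < |(x k - y k) / h N k| then ∏ i, envelope K 0 ((x i - y i) / h N i) else 0 := by
        refine le_trans (le_of_eq ?_) (Finset.single_le_sum (fun k _ => hs0 k) (Finset.mem_univ k))
        rw [if_pos hk]
      have h2 : |q y - q x| ≤ 2 * Q := by
        have h3 := hQ x
        have h4 := hQ y
        rw [Real.norm_eq_abs] at h3 h4
        exact (abs_sub _ _).trans (by linarith)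
      calc prodKernel K (h N) x y * |q y - q x|
          ≤ (∏ i, envelope K 0 ((x i - y i) / h N i)) * (2 * Q) :=
            mul_le_mul hke h2 (abs_nonneg _) (hk0.trans hke)
        _ ≤ _ := by nlinarith [hk0.trans hke]
    · push Not at hxy
      have h1 : |q y - q x| ≤ ε := by
        refine (hη' ?_).le
        rw [dist_comm]
        refine lt_of_le_of_lt ((dist_pi_le_iff (by positivity : 0 ≤ η / 2)).2 fun i => ?_)
          (half_lt_self hη)
        have := hxy i
        rw [abs_div, abs_of_pos (hpos N i), div_le_iff₀ (hpos N i)] at this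
        rw [Real.dist_eq]
        exact this.trans (hN i).le
      calc prodKernel K (h N) x y * |q y - q x|
          ≤ (∏ i, envelope K 0 ((x i - y i) / h N i)) * ε :=
            mul_le_mul hke h1 (abs_nonneg _) (hk0.trans hke)
        _ ≤ _ := by
          have := mul_nonneg (by positivity : 0 ≤ 2 * Q)
            (Finset.sum_nonneg fun k (_ : k ∈ Finset.univ) => hs0 k)
          linarith
  have hi : ∀ n : Fin N, Integrable (fun y => prodKernel K (h N) (z n) y * (q y - q (z n))) π :=
    fun n => by
      refine integrable_of_abs_le (B := K 0 ^ d * (2 * Q))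
        ((measurable_prodKernel hK _ _).mul (hq.measurable.sub_const _)) fun y => ?_
      rw [abs_mul, abs_of_nonneg (prodKernel_nonneg hK _ _)]
      refine mul_le_mul (prodKernel_le hK _ _ _) ?_ (abs_nonneg _) (pow_nonneg (hK.nonneg 0) d)
      have h3 := hQ (z n)
      have h4 := hQ y
      rw [Real.norm_eq_abs] at h3 h4
      exact (abs_sub _ _).trans (by linarith)
  have hki : ∀ n : Fin N, Integrable (prodKernel K (h N) (z n)) π :=
    fun n => integrable_prodKernel hK _ _ π
  have heq : ∀ n : Fin N, ∫ y, prodKernel K (h N) (z n) y * q y ∂π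
      - q (z n) * ∫ y, prodKernel K (h N) (z n) y ∂π
      = ∫ y, prodKernel K (h N) (z n) y * (q y - q (z n)) ∂π := fun n => by
    have : ∀ y, prodKernel K (h N) (z n) y * q y
        = prodKernel K (h N) (z n) y * (q y - q (z n)) + q (z n) * prodKernel K (h N) (z n) y :=
      fun y => by ring
    simp_rw [this]
    rw [integral_add (hi n) ((hki n).const_mul _), integral_const_mul]
    ring
  refine lt_of_le_of_lt ?_ hεe
  calc |∑ n, invMass K (h N) (sample z N) n * g (z n) *
        (∫ y, prodKernel K (h N) (z n) y * q y ∂π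
          - q (z n) * ∫ y, prodKernel K (h N) (z n) y ∂π)|
      ≤ ∑ n, G * ∫ y, invMass K (h N) (sample z N) n *
          (prodKernel K (h N) (z n) y * |q y - q (z n)|) ∂π := by
        refine (Finset.abs_sum_le_sum_abs _ _).trans (Finset.sum_le_sum fun n _ => ?_)
        rw [heq, abs_mul, abs_mul, abs_of_nonneg (hq0 n), integral_const_mul,
          mul_comm (invMass _ _ _ _), mul_assoc]
        refine mul_le_mul (hG _) (mul_le_mul_of_nonneg_left ?_ (hq0 n))
          (mul_nonneg (hq0 n) (abs_nonneg _)) hG0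
        refine abs_integral_le_integral_abs.trans (le_of_eq (integral_congr_ae
          (ae_of_all _ fun y => ?_)))
        simp only [abs_mul, abs_of_nonneg (prodKernel_nonneg (h := h N) hK (z n) y)]
    _ = G * ∫ y, ∑ n, invMass K (h N) (sample z N) n *
          (prodKernel K (h N) (z n) y * |q y - q (z n)|) ∂π := by
        rw [← Finset.mul_sum, integral_finsetSum]
        intro n _
        refine Integrable.const_mul ((hi n).abs.congr (ae_of_all _ fun y => ?_)) _
        simp only [abs_mul, abs_of_nonneg (prodKernel_nonneg (h := h N) hK (z n) y)]
    _ ≤ G * ((ρ + 2 * Q * d) * ε) := by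
        refine mul_le_mul_of_nonneg_left ?_ hG0
        have hb : ∀ y, ∑ n, invMass K (h N) (sample z N) n *
            (prodKernel K (h N) (z n) y * |q y - q (z n)|) ≤ (ρ + 2 * Q * d) * ε := by
          intro y
          refine (Finset.sum_le_sum fun (n : Fin N) _ => mul_le_mul_of_nonneg_left
            (hpt (z n) y) (hq0 n)).trans ?_
          simp_rw [mul_add, Finset.sum_add_distrib, mul_left_comm (invMass _ _ _ _),
            ← Finset.mul_sum]
          have h1 := hρ N (sample z N) (h N) y (hpos N)
          have h2 : ∑ n, invMass K (h N) (sample z N) n * ∑ k : Fin d,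
              (if L < |(z n k - y k) / h N k| then
                ∏ i, envelope K 0 ((z n i - y i) / h N i) else 0) ≤ d * ε := by
            simp_rw [Finset.mul_sum]
            rw [Finset.sum_comm]
            refine (Finset.sum_le_sum fun k _ => hL N (sample z N) (h N) y k (hpos N)).trans ?_
            simp
          have h3 := mul_le_mul_of_nonneg_left h1 hε.le
          have h4 := mul_le_mul_of_nonneg_left h2 (by positivity : 0 ≤ 2 * Q)
          simp only [sample] at h3 h4 ⊢
          linarith
        have := integral_mono_of_nonneg (μ := π) (ae_of_all _ fun y => Finset.sum_nonneg
          fun (n : Fin N) _ => mul_nonneg (hq0 n)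
            (mul_nonneg (prodKernel_nonneg (h := h N) hK (z n) y) (abs_nonneg (q y - q (z n)))))
          (integrable_const _) (ae_of_all _ hb)
        simpa using this
    _ = _ := by ring

end Limits

/-! ### The kernel-density weights -/

section Weights

variable {d N : ℕ} {K : ℝ → ℝ}

/-- The normalised weight of the `n`-th sample point: the smoothed product of the empirical
marginals over the smoothed empirical measure. -/
def productWeight (K : ℝ → ℝ) (h : Fin d → ℝ) (X : Fin N → Fin d → ℝ) (n : Fin N) : ℝ :=
  invMass K h X n * ∏ i, (∑ m, K ((X n i - X m i) / h i)) / N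

lemma integral_prodKernel_pi_empirical [NeZero N] (h : Fin d → ℝ) (X : Fin N → Fin d → ℝ)
    (x : Fin d → ℝ) :
    ∫ y, prodKernel K h x y ∂(Measure.pi fun i => empirical fun n => X n i)
      = ∏ i, (∑ m, K ((x i - X m i) / h i)) / N := by
  simp only [prodKernel]
  rw [integral_fintype_prod_eq_prod (f := fun i t => K ((x i - t) / h i))]
  simp_rw [integral_empirical]

/-- By Fubini the product of the marginal estimates is the smoothing of one measure, so it can be
compared with the smoothing in the denominator by changing the measure. -/
lemma productWeight_eq [NeZero N] (h : Fin d → ℝ) (X : Fin N → Fin d → ℝ) (n : Fin N) :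
    productWeight K h X n = invMass K h X n *
      ∫ y, prodKernel K h (X n) y ∂(Measure.pi fun i => empirical fun n => X n i) := by
  rw [productWeight, integral_prodKernel_pi_empirical]

lemma productWeight_pos (hK : IsSmoothingKernel K) (h : Fin d → ℝ) (X : Fin N → Fin d → ℝ)
    (n : Fin N) : 0 < productWeight K h X n := by
  have hN : (0 : ℝ) < N := by exact_mod_cast n.pos
  refine mul_pos (inv_pos.2 (sum_prodKernel_pos X hK n)) (Finset.prod_pos fun i _ => ?_)
  refine div_pos (Finset.sum_pos' (fun m _ => hK.nonneg _) ⟨n, Finset.mem_univ _, ?_⟩) hN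
  simpa using hK.zero_pos

lemma jointKDE_pos (hK : IsSmoothingKernel K) {h : Fin d → ℝ} (hpos : ∀ i, 0 < h i)
    (X : Fin N → Fin d → ℝ) (n : Fin N) : 0 < jointKDE K h X (X n) := by
  have hN : (0 : ℝ) < N := by exact_mod_cast n.pos
  exact div_pos (sum_prodKernel_pos X hK n) (mul_pos hN (Finset.prod_pos fun i _ => hpos i))

/-- The bandwidths cancel between numerator and denominator, and the 1/N of the joint estimator
leaves a factor N. -/
lemma kdeWeight_eq {h : Fin d → ℝ} (hpos : ∀ i, 0 < h i)
    (X : Fin N → Fin d → ℝ) (n : Fin N) : kdeWeight K h X n = N * productWeight K h X n := by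
  have hN : (N : ℝ) ≠ 0 := by exact_mod_cast n.pos.ne'
  have hv : ∏ i, h i ≠ 0 := (Finset.prod_pos fun i _ => hpos i).ne'
  have e : ∏ i, marginalKDE K (h i) (fun m => X m i) (X n i)
      = (∏ i, (∑ m, K ((X n i - X m i) / h i)) / N) / ∏ i, h i := by
    rw [← Finset.prod_div_distrib]
    exact Finset.prod_congr rfl fun i _ => by rw [marginalKDE, div_div]
  rw [kdeWeight, e, jointKDE, productWeight, invMass]
  simp only [prodKernel]
  field_simp

end Weights

/-! ### Weak convergence of the weighted sample -/

section CompactLimit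

variable {d : ℕ} {K : ℝ → ℝ} {h : ℕ → Fin d → ℝ} {z : ℕ → Fin d → ℝ}

/-- Mesh h itself (k = 0) suffices: the cells shrink, so a uniformly continuous function is nearly
constant on each. -/
lemma Merge.tendsto_integral (hzero : ∀ i, Tendsto (fun N => h N i) atTop (𝓝 0))
    (hpos : ∀ N i, 0 < h N i) {π₁ : ℕ → Measure (Fin d → ℝ)} {π₂ : Measure (Fin d → ℝ)}
    (h₁ : ∀ᶠ N in atTop, IsProbabilityMeasure (π₁ N)) [IsProbabilityMeasure π₂]
    (hm : Merge h π₁ π₂) {g : (Fin d → ℝ) → ℝ} (hg : Continuous g) (hgs : HasCompactSupport g) :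
    Tendsto (fun N => ∫ y, g y ∂(π₁ N)) atTop (𝓝 (∫ y, g y ∂π₂)) := by
  obtain ⟨G, hG⟩ := hgs.exists_bound_of_continuous hg
  have hG0 : 0 ≤ G := (norm_nonneg _).trans (hG 0)
  have hgu := hgs.uniformContinuous_of_continuous hg
  rw [Metric.tendsto_nhds]
  intro e he
  obtain ⟨η, hη, hη'⟩ := Metric.uniformContinuous_iff.1 hgu (e / 4) (by positivity)
  have hε : 0 < e / (4 * (G + 1)) := by positivity
  have hle : ∀ᶠ N in atTop, ∀ i, h N i < η / 2 := eventually_all.2 fun i =>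
    (hzero i).eventually (gt_mem_nhds (by positivity))
  filter_upwards [h₁, hm 0 _ hε, hle] with N hN1 hN2 hN3
  have hs : ∀ i, 0 < ((0 : ℕ) + 1 : ℝ)⁻¹ * h N i := fun i => mul_pos (by norm_num) (hpos N i)
  set s : Fin d → ℝ := fun i => ((0 : ℕ) + 1 : ℝ)⁻¹ * h N i with hsd
  have hcl := hN2.abs_sub_le (φ := fun c => g (corner s c)) fun c => hG _
  have hcm : Measurable fun y => g (corner s (cell s y)) :=
    measurable_comp_cell (fun c => g (corner s c)) s
  have hd : ∀ y, ‖g y - g (corner s (cell s y))‖ ≤ e / 4 := fun y => by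
    rw [← dist_eq_norm]
    refine (hη' (lt_of_le_of_lt ((dist_pi_le_iff (by positivity : 0 ≤ η / 2)).2 fun i => ?_)
      (half_lt_self hη))).le
    rw [Real.dist_eq]
    refine (abs_sub_corner_cell_le hs y i).trans ?_
    simpa [hsd] using (hN3 i).le
  have hπ : ∀ π : Measure (Fin d → ℝ), IsProbabilityMeasure π →
      |∫ y, g y ∂π - ∫ y, g (corner s (cell s y)) ∂π| ≤ e / 4 := fun π _ => by
    rw [← integral_sub (integrable_of_abs_le hg.measurable hG)
      (integrable_of_abs_le hcm fun y => hG _)]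
    simpa using norm_integral_le_of_norm_le_const (μ := π) (ae_of_all _ hd)
  have a1 := hπ _ hN1
  have a2 := hπ π₂ inferInstance
  have hGe : G * (e / (4 * (G + 1))) ≤ e / 4 := by
    rw [mul_div_assoc', div_le_div_iff₀ (by positivity) (by norm_num)]
    nlinarith
  rw [Real.dist_eq]
  rw [abs_le] at a1 a2 hcl
  rw [abs_lt]
  constructor <;> linarith [a1.1, a1.2, a2.1, a2.2, hcl.1, hcl.2]

lemma Merge.pi_empirical {π : Measure (Fin d → ℝ)} [IsProbabilityMeasure π]
    (hm : Merge h (fun N => empirical (sample z N)) π) :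
    Merge h (fun N => Measure.pi fun i => empirical fun n => sample z N n i)
      (Measure.pi fun i => π.map fun y => y i) := by
  intro k ε hε
  -- Exchanging the marginals multiplies the error by d; dividing by d + 1 also covers d = 0.
  filter_upwards [hm k (ε / (d + 1)) (by positivity), eventually_ge_atTop 1] with N hN h1
  have : NeZero N := ⟨by lia⟩
  intro φ hφ
  refine (hN.pi_empirical φ hφ).trans ?_
  rw [mul_div_assoc', div_le_iff₀ (by positivity)]
  nlinarith

/-- Weak convergence of the weighted empirical measure to the product of the marginals. -/
lemma tendsto_sum_productWeight_mul (hK : IsSmoothingKernel K) (hpos : ∀ N i, 0 < h N i)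
    (hzero : ∀ i, Tendsto (fun N => h N i) atTop (𝓝 0)) {π P : Measure (Fin d → ℝ)}
    [IsProbabilityMeasure π] (hP : P = Measure.pi fun i => π.map fun y => y i)
    (hac : π ≪ volume) (hover : P ≪ π) (hm : Merge h (fun N => empirical (sample z N)) π)
    {g : (Fin d → ℝ) → ℝ} (hg : Continuous g) (hgs : HasCompactSupport g) :
    Tendsto (fun N => ∑ n, productWeight K (h N) (sample z N) n * g (z n)) atTop
      (𝓝 (∫ y, g y ∂P)) := by
  have hmarg : ∀ i, IsProbabilityMeasure (π.map fun y : Fin d → ℝ => y i) := fun i =>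
    Measure.isProbabilityMeasure_map (measurable_pi_apply i).aemeasurable
  have hPp : IsProbabilityMeasure P := by rw [hP]; infer_instance
  have hleb : P.HaveLebesgueDecomposition π :=
    Measure.haveLebesgueDecomposition_of_sigmaFinite P π
  have hp0 : Integrable fun u => |u| ^ 0 * K u := by simpa using hK.integrable
  obtain ⟨G, hG⟩ := hgs.exists_bound_of_continuous hg
  have hG' : ∀ x, |g x| ≤ G := hG
  have hG0 : 0 ≤ G := (norm_nonneg _).trans (hG 0)
  obtain ⟨ρ, hρ0, hρ⟩ := exists_sum_envelope_le hK hp0 d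
  set p : (Fin d → ℝ) → ℝ := fun x => (P.rnDeriv π x).toReal with hp
  have hdens : ∀ f : (Fin d → ℝ) → ℝ, ∫ y, f y ∂P = ∫ y, f y * p y ∂π := fun f => by
    rw [← integral_rnDeriv_smul hover]
    simp only [hp, smul_eq_mul, mul_comm]
  have hpi : Integrable p π := Measure.integrable_toReal_rnDeriv
  rw [Metric.tendsto_nhds]
  intro e he
  set ε := e / (6 * (G * (ρ + 1) + 1)) with hεdef
  have hD : 0 ≤ G * (ρ + 1) := by positivity
  have hε : 0 < ε := by positivity
  have hεe : G * (ρ + 1) * ε ≤ e / 6 := by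
    rw [hεdef, mul_div_assoc', div_le_div_iff₀ (by positivity) (by norm_num)]
    nlinarith
  -- The density `p` is merely integrable, so it is approximated in L¹(π) by a continuous compactly
  -- supported function.
  obtain ⟨q, hqs, hqε, hq, hqi⟩ := hpi.exists_hasCompactSupport_integral_sub_le hε
  have hN0 : ∀ᶠ N : ℕ in atTop, NeZero N := by
    filter_upwards [eventually_ge_atTop 1] with N hN using ⟨by lia⟩
  -- The links of the chain: `t1` replaces the product of empirical marginals by `P`, `t2` takes `q`
  -- out of the smoothing, `t3` replaces `π` by the empirical measure, and `t4` is the limit of the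
  -- resulting sample mean. The exchange of `p` for `q` is made in `e2` and `hlim`.
  have t1 := tendsto_sum_invMass_mul_sub (z := z) hK hpos hzero
    (π₁ := fun N => Measure.pi fun i => empirical fun n => sample z N n i) (π₂ := P)
    (hN0.mono fun N _ => inferInstance) (hover.trans hac) (hP ▸ hm.pi_empirical) hg hgs
  have t2 := tendsto_sum_invMass_mul_integral_mul_sub (z := z) (π := π) hK hpos hzero hG' hq hqs
  have hgq : Continuous fun x => g x * q x := hg.mul hq
  have hgqs : HasCompactSupport fun x => g x * q x := hgs.mul_right
  have t3 := tendsto_sum_invMass_mul_sub (z := z) hK hpos hzero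
    (π₁ := fun N => empirical (sample z N)) (π₂ := π)
    (hN0.mono fun N _ => inferInstance) hac hm hgq hgqs
  have t4 := hm.tendsto_integral hzero hpos (hN0.mono fun N _ => inferInstance) hgq hgqs
  have hgpi : Integrable (fun y => g y * p y) π := hpi.bdd_mul hg.aestronglyMeasurable
    (ae_of_all _ hG)
  have hgqi : Integrable (fun y => g y * q y) π := hqi.bdd_mul hg.aestronglyMeasurable
    (ae_of_all _ hG)
  have hlim : |∫ y, g y * q y ∂π - ∫ y, g y ∂P| ≤ G * ε := by
    rw [hdens, ← integral_sub hgqi hgpi]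
    refine abs_integral_le_integral_abs.trans ?_
    refine le_trans (integral_mono (hgqi.sub hgpi).abs ((hpi.sub hqi).norm.const_mul G)
      fun y => ?_) (le_of_eq (integral_const_mul _ _) |>.trans
        (mul_le_mul_of_nonneg_left hqε hG0))
    simp only [Pi.sub_apply, ← mul_sub, abs_mul, Real.norm_eq_abs]
    rw [abs_sub_comm (p y)]
    exact mul_le_mul_of_nonneg_right (hG' y) (abs_nonneg _)
  have he6 : 0 < e / 6 := by positivity
  rw [Metric.tendsto_nhds] at t1 t2 t3 t4
  filter_upwards [hN0, t1 _ he6, t2 _ he6, t3 _ he6, t4 _ he6] with N hN1 s1 s2 s3 s4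
  simp only [dist_zero_right, Real.norm_eq_abs] at s1 s2 s3
  rw [Real.dist_eq] at s4 ⊢
  have hq0 := invMass_nonneg (h := h N) (sample z N) hK
  have e1 : ∑ n, productWeight K (h N) (sample z N) n * g (z n)
      = ∑ n, invMass K (h N) (sample z N) n * g (z n) * ∫ y, prodKernel K (h N) (z n) y
        ∂(Measure.pi fun i => empirical fun n => sample z N n i) := by
    refine Finset.sum_congr rfl fun n _ => ?_
    rw [productWeight_eq, mul_right_comm]
    rfl
  -- The smoothed empirical measure at z n is 1/N times the mass whose inverse is `invMass`, so each
  -- summand collapses to g q / N.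
  have e3 : ∑ n, invMass K (h N) (sample z N) n * (g (z n) * q (z n)) *
      ∫ y, prodKernel K (h N) (z n) y ∂(empirical (sample z N))
      = ∫ y, g y * q y ∂(empirical (sample z N)) := by
    rw [integral_empirical, Finset.sum_div]
    refine Finset.sum_congr rfl fun n _ => ?_
    rw [integral_empirical, invMass]
    have := (sum_prodKernel_pos (h := h N) (sample z N) hK n).ne'
    simp only [sample] at this ⊢
    field_simp
  -- The sum of `invMass` times the kernel is at most `ρ` for each y, so L¹ closeness of `p` and `q`
  -- is enough and no bound on `p` is required.
  have e2 : |∑ n, invMass K (h N) (sample z N) n * g (z n) * ∫ y, prodKernel K (h N) (z n) y ∂P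
      - ∑ n, invMass K (h N) (sample z N) n * g (z n) *
        ∫ y, prodKernel K (h N) (z n) y * q y ∂π| ≤ G * (ρ * ε) := by
    have hkp : ∀ n : Fin N, Integrable (fun y => prodKernel K (h N) (z n) y * p y) π := fun n =>
      hpi.bdd_mul (c := K 0 ^ d) (measurable_prodKernel hK _ _).aestronglyMeasurable
        (ae_of_all _ fun y => by
          rw [Real.norm_of_nonneg (prodKernel_nonneg hK _ _)]
          exact prodKernel_le hK _ _ _)
    have hkq : ∀ n : Fin N, Integrable (fun y => prodKernel K (h N) (z n) y * q y) π := fun n =>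
      hqi.bdd_mul (c := K 0 ^ d) (measurable_prodKernel hK _ _).aestronglyMeasurable
        (ae_of_all _ fun y => by
          rw [Real.norm_of_nonneg (prodKernel_nonneg hK _ _)]
          exact prodKernel_le hK _ _ _)
    have hkpq : ∀ n : Fin N,
        Integrable (fun y => prodKernel K (h N) (z n) y * |p y - q y|) π := fun n =>
      ((hkp n).sub (hkq n)).abs.congr (ae_of_all _ fun y => by
        simp only [Pi.sub_apply, ← mul_sub, abs_mul,
          abs_of_nonneg (prodKernel_nonneg (h := h N) hK (z n) y)])
    rw [← Finset.sum_sub_distrib]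
    calc |∑ n, (invMass K (h N) (sample z N) n * g (z n) * ∫ y, prodKernel K (h N) (z n) y ∂P
          - invMass K (h N) (sample z N) n * g (z n) *
            ∫ y, prodKernel K (h N) (z n) y * q y ∂π)|
        ≤ ∑ n, G * ∫ y, invMass K (h N) (sample z N) n *
            (prodKernel K (h N) (z n) y * |p y - q y|) ∂π := by
          refine (Finset.abs_sum_le_sum_abs _ _).trans (Finset.sum_le_sum fun n _ => ?_)
          have e4 : ∫ y, prodKernel K (h N) (z n) y ∂P
              = ∫ y, prodKernel K (h N) (z n) y * p y ∂π := hdens _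
          rw [← mul_sub, e4, ← integral_sub (hkp n) (hkq n), abs_mul, abs_mul,
            abs_of_nonneg (hq0 n), integral_const_mul, mul_comm (invMass _ _ _ _), mul_assoc]
          refine mul_le_mul (hG _) (mul_le_mul_of_nonneg_left ?_ (hq0 n))
            (mul_nonneg (hq0 n) (abs_nonneg _)) hG0
          refine abs_integral_le_integral_abs.trans (le_of_eq (integral_congr_ae
            (ae_of_all _ fun y => ?_)))
          simp only [← mul_sub, abs_mul, abs_of_nonneg (prodKernel_nonneg (h := h N) hK (z n) y)]
      _ = G * ∫ y, ∑ n, invMass K (h N) (sample z N) n *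
            (prodKernel K (h N) (z n) y * |p y - q y|) ∂π := by
          rw [← Finset.mul_sum, integral_finsetSum _ fun n _ => (hkpq n).const_mul _]
      _ ≤ G * ∫ y, ρ * |p y - q y| ∂π := by
          refine mul_le_mul_of_nonneg_left (integral_mono
            (integrable_finsetSum _ fun n _ => (hkpq n).const_mul _)
            ((hpi.sub hqi).abs.const_mul _) fun y => ?_) hG0
          simp only [← mul_assoc]
          rw [← Finset.sum_mul]
          refine mul_le_mul_of_nonneg_right ?_ (abs_nonneg _)
          exact (Finset.sum_le_sum fun n _ => mul_le_mul_of_nonneg_left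
            (prodKernel_le_envelope hK 0 _ _ _) (hq0 n)).trans (hρ N _ _ y (hpos N))
      _ ≤ G * (ρ * ε) := by
          rw [integral_const_mul]
          exact mul_le_mul_of_nonneg_left (mul_le_mul_of_nonneg_left hqε hρ0) hG0
  simp_rw [mul_sub, Finset.sum_sub_distrib] at s1 s2 s3
  rw [e3] at s3
  rw [e1]
  have e5 : ∑ n : Fin N, invMass K (h N) (sample z N) n * (g (z n) * q (z n)) *
      ∫ y, prodKernel K (h N) (z n) y ∂π = ∑ n : Fin N, invMass K (h N) (sample z N) n * g (z n) *
      (q (z n) * ∫ y, prodKernel K (h N) (z n) y ∂π) :=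
    Finset.sum_congr rfl fun n _ => by ring
  rw [e5] at s3
  have hfin : G * (ρ * ε) + G * ε ≤ e / 6 := by linarith
  rw [abs_lt] at s1 s2 s3 s4 ⊢
  rw [abs_le] at e2 hlim
  constructor <;> linarith [e2.1, e2.2, hlim.1, hlim.2, s1.1, s1.2, s2.1, s2.2, s3.1, s3.2,
    s4.1, s4.2]

end CompactLimit

/-! ### Moment weights and uniform integrability -/

/-- The one-dimensional weight controlling all moments up to order `p`. -/
def momentWeight (p : ℕ) (t : ℝ) : ℝ := (1 + |t|) ^ p

/-- The part of `momentWeight` outside of `[-R, R]`. -/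
def tailWeight (p : ℕ) (R t : ℝ) : ℝ := if R < |t| then momentWeight p t else 0

section Weights

variable {p : ℕ}

lemma momentWeight_pos (p : ℕ) (t : ℝ) : 0 < momentWeight p t := by
  unfold momentWeight
  positivity

lemma abs_pow_le_momentWeight {a : ℕ} (ha : a ≤ p) (t : ℝ) : |t| ^ a ≤ momentWeight p t :=
  (pow_le_pow_left₀ (abs_nonneg t) (by linarith) a).trans
    (pow_le_pow_right₀ (by linarith [abs_nonneg t]) ha)

lemma tailWeight_nonneg (p : ℕ) (R t : ℝ) : 0 ≤ tailWeight p R t := by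
  unfold tailWeight
  split_ifs
  exacts [(momentWeight_pos p t).le, le_rfl]

lemma tailWeight_le (p : ℕ) (R t : ℝ) : tailWeight p R t ≤ momentWeight p t := by
  unfold tailWeight
  split_ifs
  exacts [le_rfl, (momentWeight_pos p t).le]

lemma measurable_momentWeight (p : ℕ) : Measurable (momentWeight p) := by
  unfold momentWeight
  fun_prop

lemma measurable_tailWeight (p : ℕ) (R : ℝ) : Measurable (tailWeight p R) :=
  Measurable.ite (measurableSet_lt measurable_const (by fun_prop)) (measurable_momentWeight p)
    measurable_const

lemma integrable_momentWeight {α : Type*} [MeasurableSpace α] {ν : Measure α} [IsFiniteMeasure ν]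
    {f : α → ℝ} (hf : Measurable f) (hi : Integrable (fun x => |f x| ^ p) ν) :
    Integrable (fun x => momentWeight p (f x)) ν := by
  have h2 : Integrable (fun x => 2 ^ (p - 1) * (1 + |f x| ^ p)) ν :=
    ((integrable_const 1).add hi).const_mul _
  refine h2.mono' ((measurable_momentWeight p).comp hf).aestronglyMeasurable
    (ae_of_all _ fun x => ?_)
  rw [Real.norm_of_nonneg (momentWeight_pos p _).le]
  simpa [momentWeight] using add_pow_le zero_le_one (abs_nonneg (f x)) p

lemma integrable_tailWeight {α : Type*} [MeasurableSpace α] {ν : Measure α}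
    {f : α → ℝ} (hf : Measurable f) (hi : Integrable (fun x => momentWeight p (f x)) ν) (R : ℝ) :
    Integrable (fun x => tailWeight p R (f x)) ν :=
  hi.mono' ((measurable_tailWeight p R).comp hf).aestronglyMeasurable (ae_of_all _ fun x => by
    rw [Real.norm_of_nonneg (tailWeight_nonneg p R _)]
    exact tailWeight_le p R _)

lemma tendsto_integral_tailWeight {α : Type*} [MeasurableSpace α] {ν : Measure α}
    {f : α → ℝ} (hf : Measurable f) (hi : Integrable (fun x => momentWeight p (f x)) ν) :
    Tendsto (fun R : ℕ => ∫ x, tailWeight p R (f x) ∂ν) atTop (𝓝 0) := by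
  rw [← integral_zero α ℝ]
  refine tendsto_integral_of_dominated_convergence (fun x => momentWeight p (f x))
    (fun R => (integrable_tailWeight hf hi R).aestronglyMeasurable) hi
    (fun R => ae_of_all _ fun x => ?_) (ae_of_all _ fun x => ?_)
  · rw [Real.norm_of_nonneg (tailWeight_nonneg p R _)]
    exact tailWeight_le p R _
  · refine tendsto_const_nhds.congr' ?_
    filter_upwards [tendsto_natCast_atTop_atTop.eventually_ge_atTop |f x|] with R hR
    rw [tailWeight, if_neg (not_lt.2 hR)]

/-- Since 1 + |t| + |u| ≤ (1 + |t|)(1 + |u|), the weight moves from one point to another at the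
price of a polynomial factor, which `envelope` absorbs. -/
lemma momentWeight_le_mul {s t u : ℝ} (h : |s - t| ≤ |u|) (p : ℕ) :
    momentWeight p s ≤ momentWeight p t * (1 + |u|) ^ p := by
  rw [momentWeight, momentWeight, ← mul_pow]
  refine pow_le_pow_left₀ (by positivity) ?_ p
  have := abs_sub_abs_le_abs_sub s t
  nlinarith [abs_nonneg t, abs_nonneg u]

lemma integrable_empirical {E : Type*} [MeasurableSpace E] [MeasurableSingletonClass E] {N : ℕ}
    [NeZero N] (X : Fin N → E) (f : E → ℝ) : Integrable f (empirical X) := by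
  refine Integrable.smul_measure (integrable_finsetSum_measure.2 fun n _ =>
    integrable_dirac (by simp)) ?_
  simpa using NeZero.ne N

end Weights

section Tail

variable {d p : ℕ} {K : ℝ → ℝ} {h : ℕ → Fin d → ℝ} {z : ℕ → Fin d → ℝ}

/-- If |x_k| > 2R, then |y_k| > R or |x_k - y_k| > R, and the latter persists in bandwidth units
because h_k ≤ 1. The first sum is a tail in y, the second a tail of the kernel. -/
lemma tail_mul_prodKernel_le (hK : IsSmoothingKernel K) {h : Fin d → ℝ} (hpos : ∀ i, 0 < h i)
    (h1 : ∀ i, h i ≤ 1) (R : ℝ) (x y : Fin d → ℝ) :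
    (if ∃ k, 2 * R < |x k| then ∏ i, momentWeight p (x i) else 0) * prodKernel K h x y
      ≤ (∑ k, if R < |y k| then ∏ i, momentWeight p (y i) else 0) *
          (∏ i, envelope K p ((x i - y i) / h i))
        + (∏ i, momentWeight p (y i)) * ∑ k, if R < |(x k - y k) / h k| then
          ∏ i, envelope K p ((x i - y i) / h i) else 0 := by
  have hE0 : 0 ≤ ∏ i, envelope K p ((x i - y i) / h i) :=
    Finset.prod_nonneg fun i _ => envelope_nonneg hK p _
  have hV0 : 0 ≤ ∏ i, momentWeight p (y i) :=
    Finset.prod_nonneg fun i _ => (momentWeight_pos p _).le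
  have hs1 : ∀ k : Fin d, 0 ≤ if R < |y k| then ∏ i, momentWeight p (y i) else 0 := fun k => by
    split_ifs
    exacts [hV0, le_rfl]
  have hs2 : ∀ k : Fin d, 0 ≤ if R < |(x k - y k) / h k| then
      ∏ i, envelope K p ((x i - y i) / h i) else 0 := fun k => by
    split_ifs
    exacts [hE0, le_rfl]
  have hS1 := Finset.sum_nonneg fun k (_ : k ∈ Finset.univ) => hs1 k
  have hS2 := Finset.sum_nonneg fun k (_ : k ∈ Finset.univ) => hs2 k
  have hu : ∀ i, |x i - y i| ≤ |(x i - y i) / h i| := fun i => by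
    rw [abs_div, abs_of_pos (hpos i), le_div_iff₀ (hpos i)]
    exact mul_le_of_le_one_right (abs_nonneg _) (h1 i)
  split_ifs with hx
  · obtain ⟨k, hk⟩ := hx
    have hle : (∏ i, momentWeight p (x i)) * prodKernel K h x y
        ≤ (∏ i, momentWeight p (y i)) * ∏ i, envelope K p ((x i - y i) / h i) := by
      rw [prodKernel, ← Finset.prod_mul_distrib, ← Finset.prod_mul_distrib]
      refine Finset.prod_le_prod (fun i _ => mul_nonneg (momentWeight_pos p _).le (hK.nonneg _))
        fun i _ => ?_
      calc momentWeight p (x i) * K ((x i - y i) / h i)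
          ≤ momentWeight p (y i) * (1 + |(x i - y i) / h i|) ^ p * K ((x i - y i) / h i) :=
            mul_le_mul_of_nonneg_right (momentWeight_le_mul (hu i) p) (hK.nonneg _)
        _ ≤ _ := by
          rw [mul_assoc]
          exact mul_le_mul_of_nonneg_left (pow_mul_le_envelope hK p _) (momentWeight_pos p _).le
    refine hle.trans ?_
    by_cases hy : R < |y k|
    · have : ∏ i, momentWeight p (y i)
          ≤ ∑ k, if R < |y k| then ∏ i, momentWeight p (y i) else 0 := by
        refine le_trans (le_of_eq ?_) (Finset.single_le_sum (fun k _ => hs1 k) (Finset.mem_univ k))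
        rw [if_pos hy]
      have h2 := mul_le_mul_of_nonneg_right this hE0
      have h3 := mul_nonneg hV0 hS2
      linarith
    · have hk' : R < |(x k - y k) / h k| := by
        have h2 := abs_sub_abs_le_abs_sub (x k) (y k)
        have h3 := hu k
        linarith
      have : ∏ i, envelope K p ((x i - y i) / h i) ≤ ∑ k, if R < |(x k - y k) / h k| then
          ∏ i, envelope K p ((x i - y i) / h i) else 0 := by
        refine le_trans (le_of_eq ?_) (Finset.single_le_sum (fun k _ => hs2 k) (Finset.mem_univ k))
        rw [if_pos hk']
      have h2 := mul_le_mul_of_nonneg_left this hV0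
      have h3 := mul_nonneg hS1 hE0
      linarith
  · rw [zero_mul]
    exact add_nonneg (mul_nonneg hS1 hE0) (mul_nonneg hV0 hS2)

/-- The product form lets the tail be integrated factor by factor against a product measure. -/
lemma ite_prod_momentWeight (R : ℝ) (k : Fin d) (y : Fin d → ℝ) :
    (if R < |y k| then ∏ i, momentWeight p (y i) else 0)
      = ∏ i, if i = k then tailWeight p R (y i) else momentWeight p (y i) := by
  rw [← Finset.mul_prod_erase _ (fun i => if i = k then tailWeight p R (y i) else _)
    (Finset.mem_univ k), ← Finset.mul_prod_erase _ (fun i => momentWeight p (y i))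
    (Finset.mem_univ k), if_pos rfl, tailWeight]
  have e : ∏ i ∈ Finset.univ.erase k, (if i = k then tailWeight p R (y i) else momentWeight p (y i))
      = ∏ i ∈ Finset.univ.erase k, momentWeight p (y i) :=
    Finset.prod_congr rfl fun i hi => if_neg (Finset.ne_of_mem_erase hi)
  rw [e]
  split_ifs <;> simp

/-- The weighted empirical measures are uniformly integrable with respect to the moments. -/
lemma eventually_sum_productWeight_tail_le (hK : IsSmoothingKernel K)
    (hp : Integrable fun u => |u| ^ p * K u) (hpos : ∀ N i, 0 < h N i)
    (hzero : ∀ i, Tendsto (fun N => h N i) atTop (𝓝 0)) {π : Measure (Fin d → ℝ)}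
    (hint : ∀ i, Integrable (fun y => momentWeight p (y i)) π)
    (hmom : ∀ i, Tendsto (fun N : ℕ => (∑ n : Fin N, momentWeight p (z n i)) / N) atTop
      (𝓝 (∫ y, momentWeight p (y i) ∂π)))
    (htail : ∀ i, ∀ R : ℕ, Tendsto (fun N : ℕ => (∑ n : Fin N, tailWeight p R (z n i)) / N) atTop
      (𝓝 (∫ y, tailWeight p R (y i) ∂π))) {ε : ℝ} (hε : 0 < ε) :
    ∀ᶠ R : ℕ in atTop, ∀ᶠ N in atTop, ∑ n, productWeight K (h N) (sample z N) n *
      (if ∃ k, 2 * (R : ℝ) < |z n k| then ∏ i, momentWeight p (z n i) else 0) ≤ ε := by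
  obtain ⟨ρ, hρ0, hρ⟩ := exists_sum_envelope_le hK hp d
  set a : Fin d → ℝ := fun i => ∫ y, momentWeight p (y i) ∂π with ha
  have ha0 : ∀ i, 0 ≤ a i := fun i => integral_nonneg fun y => (momentWeight_pos p _).le
  set A := ∏ i, a i with hA
  have hA0 : 0 ≤ A := Finset.prod_nonneg fun i _ => ha0 i
  -- The kernel tails contribute d η times the limiting product `A` of moments, hence at most ε/4.
  set η := ε / (4 * (d * A + 1)) with hη
  have hη0 : 0 < η := by positivity
  have hηε : d * A * η ≤ ε / 4 := by
    rw [hη, mul_div_assoc', div_le_div_iff₀ (by positivity) (by norm_num)]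
    nlinarith [mul_nonneg (Nat.cast_nonneg (α := ℝ) d) hA0]
  obtain ⟨L, hL⟩ := exists_sum_envelope_tail_le hK hp d hη0
  have hlimR : Tendsto (fun R : ℕ => ρ * ∑ k, ∏ i, if i = k then
      ∫ y, tailWeight p R (y i) ∂π else a i) atTop (𝓝 0) := by
    have : Tendsto (fun R : ℕ => ρ * ∑ k, ∏ i, if i = k then
        ∫ y, tailWeight p R (y i) ∂π else a i) atTop
        (𝓝 (ρ * ∑ k : Fin d, ∏ i, if i = k then 0 else a i)) := by
      refine (tendsto_finsetSum _ fun k _ => tendsto_finsetProd _ fun i _ => ?_).const_mul ρ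
      split_ifs
      · exact tendsto_integral_tailWeight (measurable_pi_apply i) (hint i)
      · exact tendsto_const_nhds
    have h0 : ∀ k : Fin d, ∏ i, (if i = k then 0 else a i) = 0 := fun k =>
      Finset.prod_eq_zero (Finset.mem_univ k) (if_pos rfl)
    simpa only [h0, Finset.sum_const_zero, mul_zero] using this
  filter_upwards [hlimR.eventually (gt_mem_nhds (by positivity : 0 < ε / 4)),
    tendsto_natCast_atTop_atTop.eventually_ge_atTop L] with R hR1 hR2
  have hlimN : Tendsto (fun N : ℕ => ρ * ∑ k, ∏ i, (if i = k then
      (∑ n : Fin N, tailWeight p R (z n i)) / N else (∑ n : Fin N, momentWeight p (z n i)) / N)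
      + d * η * ∏ i, (∑ n : Fin N, momentWeight p (z n i)) / N) atTop
      (𝓝 (ρ * ∑ k, ∏ i, (if i = k then ∫ y, tailWeight p R (y i) ∂π else a i)
        + d * η * A)) := by
    refine Tendsto.add ((tendsto_finsetSum _ fun k _ => tendsto_finsetProd _
      fun i _ => ?_).const_mul ρ) ((tendsto_finsetProd _ fun i _ => hmom i).const_mul _)
    split_ifs
    exacts [htail i R, hmom i]
  have hle1 : ∀ᶠ N in atTop, ∀ i, h N i ≤ 1 := eventually_all.2 fun i =>
    ((hzero i).eventually (gt_mem_nhds one_pos)).mono fun N hN => hN.le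
  filter_upwards [hlimN.eventually (gt_mem_nhds (by linarith :
    ρ * ∑ k, ∏ i, (if i = k then ∫ y, tailWeight p R (y i) ∂π else a i) + d * η * A < ε)),
    hle1, eventually_ge_atTop 1] with N hN1 hN2 hN3
  have : NeZero N := ⟨by lia⟩
  have hq0 := invMass_nonneg (h := h N) (sample z N) hK
  refine le_trans ?_ hN1.le
  set m : Fin d → Measure ℝ := fun i => empirical fun n => sample z N n i with hm
  set V : (Fin d → ℝ) → ℝ := fun y => ∏ i, momentWeight p (y i) with hV
  set T : (Fin d → ℝ) → ℝ := fun y => ∑ k, if (R : ℝ) < |y k| then V y else 0 with hT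
  have hVi : Integrable V (Measure.pi m) :=
    Integrable.fintype_prod (f := fun _ => momentWeight p) fun i => integrable_empirical _ _
  have hTi' : ∀ k, Integrable (fun y => if (R : ℝ) < |y k| then V y else 0) (Measure.pi m) := by
    intro k
    simp only [hV, ite_prod_momentWeight]
    exact Integrable.fintype_prod
      (f := fun i t => if i = k then tailWeight p R t else momentWeight p t)
      fun i => integrable_empirical _ _
  have hTi : Integrable T (Measure.pi m) := integrable_finsetSum _ fun k _ => hTi' k
  -- Under the product of the empirical marginals the weight integrates to a product of
  -- one-dimensional sample means, so no mixed moments of the joint law are needed.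
  have hVint : ∫ y, V y ∂(Measure.pi m) = ∏ i, (∑ n : Fin N, momentWeight p (z n i)) / N := by
    simp only [hV]
    rw [integral_fintype_prod_eq_prod (f := fun _ => momentWeight p)]
    simp only [hm, integral_empirical]
    rfl
  have hTint : ∫ y, T y ∂(Measure.pi m) = ∑ k, ∏ i, (if i = k then
      (∑ n : Fin N, tailWeight p R (z n i)) / N
      else (∑ n : Fin N, momentWeight p (z n i)) / N) := by
    simp only [hT]
    rw [integral_finsetSum _ fun k _ => hTi' k]
    refine Finset.sum_congr rfl fun k _ => ?_
    simp only [hV, ite_prod_momentWeight]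
    rw [integral_fintype_prod_eq_prod
      (f := fun i t => if i = k then tailWeight p R t else momentWeight p t)]
    refine Finset.prod_congr rfl fun i _ => ?_
    simp only [hm, integral_empirical]
    split_ifs <;> rfl
  have hV0 : ∀ y, 0 ≤ V y := fun y => Finset.prod_nonneg fun i _ => (momentWeight_pos p _).le
  have hT0 : ∀ y, 0 ≤ T y := fun y => Finset.sum_nonneg fun k _ => by
    split_ifs
    exacts [hV0 y, le_rfl]
  have hki : ∀ n : Fin N, Integrable (fun y => prodKernel K (h N) (z n) y) (Measure.pi m) :=
    fun n => integrable_prodKernel hK _ _ _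
  set c : Fin N → ℝ := fun n => if ∃ k, 2 * (R : ℝ) < |z n k| then V (z n) else 0 with hc
  calc ∑ n, productWeight K (h N) (sample z N) n * c n
      = ∫ y, ∑ n, invMass K (h N) (sample z N) n * (c n * prodKernel K (h N) (z n) y)
          ∂(Measure.pi m) := by
        rw [integral_finsetSum _ fun n _ => ((hki n).const_mul _).const_mul _]
        refine Finset.sum_congr rfl fun n _ => ?_
        rw [integral_const_mul, integral_const_mul, productWeight_eq]
        simp only [hm, sample]
        ring
    _ ≤ ∫ y, (ρ * T y + d * η * V y) ∂(Measure.pi m) := by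
        refine integral_mono (integrable_finsetSum _ fun n _ =>
          ((hki n).const_mul _).const_mul _) ((hTi.const_mul _).add (hVi.const_mul _)) fun y => ?_
        refine (Finset.sum_le_sum fun (n : Fin N) _ => mul_le_mul_of_nonneg_left
          (tail_mul_prodKernel_le hK (hpos N) hN2 R (z n) y) (hq0 n)).trans ?_
        simp_rw [mul_add, Finset.sum_add_distrib, mul_left_comm (invMass _ _ _ _),
          ← Finset.mul_sum]
        have h1 := hρ N (sample z N) (h N) y (hpos N)
        have h2 : ∑ n, invMass K (h N) (sample z N) n * ∑ k : Fin d,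
            (if (R : ℝ) < |(z n k - y k) / h N k| then
              ∏ i, envelope K p ((z n i - y i) / h N i) else 0) ≤ d * η := by
          simp_rw [Finset.mul_sum]
          rw [Finset.sum_comm]
          refine le_trans (Finset.sum_le_sum fun k _ => (Finset.sum_le_sum fun n _ =>
            mul_le_mul_of_nonneg_left ?_ (hq0 n)).trans
              (hL N (sample z N) (h N) y k (hpos N))) (by simp)
          have hE0 : 0 ≤ ∏ i, envelope K p ((sample z N n i - y i) / h N i) :=
            Finset.prod_nonneg fun i _ => envelope_nonneg hK p _
          split_ifs with c1 c2
          · exact le_rfl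
          · exact absurd (hR2.trans_lt c1) c2
          · exact hE0
          · exact le_rfl
        have h3 := mul_le_mul_of_nonneg_left h1 (hT0 y)
        have h4 := mul_le_mul_of_nonneg_left h2 (hV0 y)
        simp only [sample, hT, hV] at h3 h4 ⊢
        linarith
    _ = _ := by
        rw [integral_add (hTi.const_mul _) (hVi.const_mul _), integral_const_mul,
          integral_const_mul, hVint, hTint]

/-- Convergence of the weighted empirical means of all functions controlled by the moments. -/
theorem tendsto_sum_productWeight_mul_of_le (hK : IsSmoothingKernel K)
    (hp : Integrable fun u => |u| ^ p * K u) (hpos : ∀ N i, 0 < h N i)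
    (hzero : ∀ i, Tendsto (fun N => h N i) atTop (𝓝 0)) {π P : Measure (Fin d → ℝ)}
    [IsProbabilityMeasure π] (hP : P = Measure.pi fun i => π.map fun y => y i)
    (hac : π ≪ volume) (hover : P ≪ π) (hm : Merge h (fun N => empirical (sample z N)) π)
    (hint : ∀ i, Integrable (fun y => momentWeight p (y i)) π)
    (hmom : ∀ i, Tendsto (fun N : ℕ => (∑ n : Fin N, momentWeight p (z n i)) / N) atTop
      (𝓝 (∫ y, momentWeight p (y i) ∂π)))
    (htail : ∀ i, ∀ R : ℕ, Tendsto (fun N : ℕ => (∑ n : Fin N, tailWeight p R (z n i)) / N) atTop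
      (𝓝 (∫ y, tailWeight p R (y i) ∂π)))
    {g : (Fin d → ℝ) → ℝ} (hg : Continuous g) (hgV : ∀ x, |g x| ≤ ∏ i, momentWeight p (x i)) :
    Tendsto (fun N => ∑ n, productWeight K (h N) (sample z N) n * g (z n)) atTop
      (𝓝 (∫ y, g y ∂P)) := by
  have hmarg : ∀ i, IsProbabilityMeasure (π.map fun y : Fin d → ℝ => y i) := fun i =>
    Measure.isProbabilityMeasure_map (measurable_pi_apply i).aemeasurable
  have hVi : Integrable (fun y : Fin d → ℝ => ∏ i, momentWeight p (y i)) P := by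
    rw [hP]
    refine Integrable.fintype_prod (f := fun _ => momentWeight p) fun i => ?_
    exact (integrable_map_measure (measurable_momentWeight p).aestronglyMeasurable
      (measurable_pi_apply i).aemeasurable).2 (hint i)
  -- A continuous cutoff equal to 1 up to sup-norm 2R and to 0 from 2R + 1 on; the radius 2R matches
  -- the threshold of the tail estimate.
  set χ : ℕ → (Fin d → ℝ) → ℝ := fun R x => max 0 (min 1 (2 * R + 1 - ‖x‖)) with hχ
  have hχc : ∀ R, Continuous (χ R) := fun R => by
    simp only [hχ]
    fun_prop
  have hχ0 : ∀ R x, 0 ≤ χ R x := fun R x => le_max_left _ _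
  have hχ1 : ∀ R x, χ R x ≤ 1 := fun R x => max_le zero_le_one (min_le_left _ _)
  have hχs : ∀ R, HasCompactSupport (χ R) := fun R => by
    refine HasCompactSupport.intro (isCompact_closedBall 0 (2 * (R : ℝ) + 1)) fun x hx => ?_
    rw [Metric.mem_closedBall, dist_zero_right, not_le] at hx
    exact max_eq_left ((min_le_right _ _).trans (by linarith))
  have hχe : ∀ (R : ℕ) x, ‖x‖ ≤ 2 * R → χ R x = 1 := fun R x hx => by
    simp only [hχ]
    rw [min_eq_left (by linarith), max_eq_right zero_le_one]
  have hlim : Tendsto (fun R => ∫ y, g y * χ R y ∂P) atTop (𝓝 (∫ y, g y ∂P)) := by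
    refine tendsto_integral_of_dominated_convergence (fun y => ∏ i, momentWeight p (y i))
      (fun R => (hg.mul (hχc R)).aestronglyMeasurable) hVi
      (fun R => ae_of_all _ fun x => ?_) (ae_of_all _ fun x => ?_)
    · rw [Real.norm_eq_abs, abs_mul, abs_of_nonneg (hχ0 R x)]
      exact (mul_le_of_le_one_right (abs_nonneg _) (hχ1 R x)).trans (hgV x)
    · refine tendsto_const_nhds.congr' ?_
      filter_upwards [tendsto_natCast_atTop_atTop.eventually_ge_atTop ‖x‖] with R hR
      rw [hχe R x (by linarith [norm_nonneg x]), mul_one]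
  rw [Metric.tendsto_nhds] at hlim ⊢
  intro e he
  have he3 : 0 < e / 4 := by positivity
  obtain ⟨R, hR1, hR2⟩ := ((hlim _ he3).and (eventually_sum_productWeight_tail_le hK hp hpos hzero
    hint hmom htail he3)).exists
  have t := tendsto_sum_productWeight_mul (z := z) hK hpos hzero hP hac hover hm
    (hg.mul (hχc R)) ((hχs R).mul_left)
  rw [Metric.tendsto_nhds] at t
  filter_upwards [t _ he3, hR2] with N hN1 hN2
  have hw0 := fun n => (productWeight_pos hK (h N) (sample z N) n).le
  have hd : |∑ n, productWeight K (h N) (sample z N) n * g (z n)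
      - ∑ n, productWeight K (h N) (sample z N) n * (g (z n) * χ R (z n))| ≤ e / 4 := by
    rw [← Finset.sum_sub_distrib]
    refine (Finset.abs_sum_le_sum_abs _ _).trans (le_trans (Finset.sum_le_sum fun n _ => ?_) hN2)
    rw [← mul_sub, abs_mul, abs_of_nonneg (hw0 n)]
    refine mul_le_mul_of_nonneg_left ?_ (hw0 n)
    split_ifs with hx
    · have : g (z n) - g (z n) * χ R (z n) = g (z n) * (1 - χ R (z n)) := by ring
      rw [this, abs_mul, abs_of_nonneg (sub_nonneg.2 (hχ1 R (z n)))]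
      exact (mul_le_of_le_one_right (abs_nonneg _) (sub_le_self 1 (hχ0 R (z n)))).trans (hgV _)
    · push Not at hx
      rw [hχe R (z n) ((pi_norm_le_iff_of_nonneg (by positivity)).2 hx)]
      simp
  rw [Real.dist_eq] at hR1 hN1 ⊢
  simp only [Pi.mul_apply] at hN1
  rw [abs_lt] at hR1 hN1 ⊢
  rw [abs_le] at hd
  constructor <;> linarith [hR1.1, hR1.2, hN1.1, hN1.2, hd.1, hd.2]

end Tail

/-! ### Sign functions and the number of cells -/

section Grid

variable {d : ℕ}

/-- The function of the cells equal to `1` on `S`, to `-1` on `F \ S` and to `0` off `F`. -/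
def signOn [DecidableEq (Fin d → ℤ)] (F S : Finset (Fin d → ℤ)) (c : Fin d → ℤ) : ℝ :=
  if c ∈ F then (if c ∈ S then 1 else -1) else 0

lemma abs_signOn_le [DecidableEq (Fin d → ℤ)] (F S : Finset (Fin d → ℤ)) (c : Fin d → ℤ) :
    |signOn F S c| ≤ 1 := by
  unfold signOn
  split_ifs <;> simp

lemma integral_comp_cell_eq (ν : Measure (Fin d → ℝ)) [IsProbabilityMeasure ν] (s : Fin d → ℝ)
    [DecidableEq (Fin d → ℤ)] (F : Finset (Fin d → ℤ)) {φ : (Fin d → ℤ) → ℝ}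
    (hφ : ∀ c, |φ c| ≤ 1) :
    ∫ y, φ (cell s y) ∂ν = ∑ c ∈ F, φ c * (∫ y, (if cell s y = c then 1 else 0) ∂ν)
      + ∫ y, (if cell s y ∈ F then 0 else φ (cell s y)) ∂ν := by
  simp_rw [← integral_const_mul]
  have h1 : ∀ c, Integrable (fun y => φ c * (if cell s y = c then 1 else 0)) ν := fun c =>
    integrable_of_abs_le (B := 1) (measurable_comp_cell (fun c' => φ c * if c' = c then 1 else 0) s)
      fun y => by split_ifs <;> simp [hφ]
  have h2 : Integrable (fun y => if cell s y ∈ F then 0 else φ (cell s y)) ν :=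
    integrable_of_abs_le (B := 1) (measurable_comp_cell (fun c => if c ∈ F then 0 else φ c) s)
      fun y => by split_ifs <;> simp [hφ]
  rw [← integral_finsetSum _ fun c _ => h1 c, ← integral_add (integrable_finsetSum _ fun c _ => h1 c) h2]
  refine integral_congr_ae (ae_of_all _ fun y => ?_)
  simp only [mul_ite, mul_one, mul_zero, Finset.sum_ite_eq]
  split_ifs <;> simp

/-- Closeness on a grid follows from one-sided comparisons for sign functions on finitely many
cells which carry most of the mass. -/
lemma CellClose.of_signOn {ν π : Measure (Fin d → ℝ)} [IsProbabilityMeasure ν]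
    [IsProbabilityMeasure π] {s : Fin d → ℝ} [DecidableEq (Fin d → ℤ)]
    {F : Finset (Fin d → ℤ)} {t ε : ℝ}
    (ht : ∀ S ⊆ F, ∫ y, signOn F S (cell s y) ∂ν - ∫ y, signOn F S (cell s y) ∂π ≤ t)
    (hF : ∫ y, (if cell s y ∈ F then 0 else 1) ∂π ≤ ε) :
    CellClose ν π s (2 * t + 2 * ε) := by
  intro φ hφ
  set a : (Fin d → ℤ) → ℝ := fun c => ∫ y, (if cell s y = c then 1 else 0) ∂ν with ha
  set b : (Fin d → ℤ) → ℝ := fun c => ∫ y, (if cell s y = c then 1 else 0) ∂π with hb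
  have hsum : ∑ c ∈ F, |a c - b c| ≤ t := by
    -- The set of cells where `ν` has at least the mass of `π` turns the one-sided bound into the
    -- full ℓ¹ distance on `F`.
    have h1 := ht (F.filter fun c => 0 ≤ a c - b c) (Finset.filter_subset _ _)
    rw [integral_comp_cell_eq ν s F (abs_signOn_le F _),
      integral_comp_cell_eq π s F (abs_signOn_le F _)] at h1
    have h2 : ∀ (S : Finset (Fin d → ℤ)) (ρ : Measure (Fin d → ℝ)),
        ∫ y, (if cell s y ∈ F then 0 else signOn F S (cell s y)) ∂ρ = 0 := fun S ρ => by
      refine integral_eq_zero_of_ae (ae_of_all _ fun y => ?_)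
      simp only [signOn]
      split_ifs <;> simp
    rw [h2, h2, add_zero, add_zero, ← Finset.sum_sub_distrib] at h1
    refine le_trans (le_of_eq (Finset.sum_congr rfl fun c hc => ?_)) h1
    rw [← mul_sub]
    change _ = _ * (a c - b c)
    rw [signOn, if_pos hc]
    by_cases h0 : 0 ≤ a c - b c
    · rw [if_pos (by simp only [Finset.mem_filter]; exact ⟨hc, h0⟩), abs_of_nonneg h0, one_mul]
    · rw [if_neg (by simp only [Finset.mem_filter]; exact fun hm => h0 hm.2), abs_of_neg (not_le.1 h0)]
      ring
  have htot : ∀ ρ : Measure (Fin d → ℝ), IsProbabilityMeasure ρ →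
      ∑ c ∈ F, (∫ y, (if cell s y = c then (1 : ℝ) else 0) ∂ρ)
        + ∫ y, (if cell s y ∈ F then (0 : ℝ) else 1) ∂ρ = 1 := fun ρ _ => by
    have := integral_comp_cell_eq ρ s F (φ := fun _ => 1) (by simp)
    simpa using this.symm
  have hrem : ∀ ρ : Measure (Fin d → ℝ), IsProbabilityMeasure ρ →
      |∫ y, (if cell s y ∈ F then 0 else φ (cell s y)) ∂ρ|
        ≤ ∫ y, (if cell s y ∈ F then (0 : ℝ) else 1) ∂ρ := fun ρ _ => by
    refine abs_integral_le_integral_abs.trans (integral_mono ?_ ?_ fun y => ?_)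
    · exact (integrable_of_abs_le (B := 1)
        (measurable_comp_cell (fun c => if c ∈ F then 0 else φ c) s)
        fun y => by split_ifs <;> simp [hφ]).abs
    · exact integrable_of_abs_le (B := 1) (measurable_comp_cell (fun c => if c ∈ F then 0 else 1) s)
        fun y => by split_ifs <;> simp
    · simp only
      split_ifs
      · simp
      · exact hφ _
  have hdiff : |∑ c ∈ F, φ c * a c - ∑ c ∈ F, φ c * b c| ≤ t := by
    rw [← Finset.sum_sub_distrib]
    refine (Finset.abs_sum_le_sum_abs _ _).trans (le_trans (Finset.sum_le_sum fun c _ => ?_) hsum)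
    rw [← mul_sub, abs_mul]
    exact mul_le_of_le_one_left (abs_nonneg _) (hφ c)
  -- Both total masses are 1, so `ν` has at most `t` more mass off `F` than `π`; tightness is thus
  -- needed for `π` only.
  have hab : ∑ c ∈ F, b c - ∑ c ∈ F, a c ≤ t := by
    rw [← Finset.sum_sub_distrib]
    refine le_trans (Finset.sum_le_sum fun c _ => ?_) hsum
    rw [abs_sub_comm]
    exact le_abs_self _
  have n1 := htot ν inferInstance
  have n2 := htot π inferInstance
  have r1 := hrem ν inferInstance
  have r2 := hrem π inferInstance
  rw [integral_comp_cell_eq ν s F hφ, integral_comp_cell_eq π s F hφ]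
  change ∑ c ∈ F, a c + _ = _ at n1
  change ∑ c ∈ F, b c + _ = _ at n2
  change |∑ c ∈ F, φ c * a c + _ - (∑ c ∈ F, φ c * b c + _)| ≤ _
  rw [abs_le] at r1 r2 hdiff ⊢
  constructor <;> linarith [r1.1, r1.2, r2.1, r2.2, hdiff.1, hdiff.2]

/-- The cells meeting the box `[-R, R]^d`. -/
def boxCells (s : Fin d → ℝ) (R : ℝ) : Finset (Fin d → ℤ) :=
  Fintype.piFinset fun i => Finset.Icc ⌊-R / s i⌋ ⌊R / s i⌋

lemma cell_mem_boxCells {s : Fin d → ℝ} (hs : ∀ i, 0 < s i) {R : ℝ} {y : Fin d → ℝ}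
    (hy : ‖y‖ ≤ R) : cell s y ∈ boxCells s R := by
  refine Fintype.mem_piFinset.2 fun i => Finset.mem_Icc.2 ?_
  have h1 := abs_le.1 ((norm_le_pi_norm y i).trans hy)
  exact ⟨Int.floor_mono (div_le_div_of_nonneg_right h1.1 (hs i).le),
    Int.floor_mono (div_le_div_of_nonneg_right h1.2 (hs i).le)⟩

lemma card_boxCells_le {s : Fin d → ℝ} (hs : ∀ i, 0 < s i) {R : ℝ} (hR : 0 ≤ R) :
    ((boxCells s R).card : ℝ) ≤ ∏ i, (2 * R / s i + 2) := by
  rw [boxCells, Fintype.card_piFinset, Nat.cast_prod]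
  refine Finset.prod_le_prod (fun i _ => Nat.cast_nonneg _) fun i _ => ?_
  rw [Int.card_Icc]
  have h0 : 0 ≤ R / s i := div_nonneg hR (hs i).le
  have h1 := Int.floor_le (R / s i)
  have h2 := Int.lt_floor_add_one (-R / s i)
  rw [neg_div] at h2
  have h3 : ⌊-R / s i⌋ ≤ ⌊R / s i⌋ := by
    refine Int.floor_mono ?_
    rw [neg_div]
    linarith
  have h4 : (((⌊R / s i⌋ + 1 - ⌊-R / s i⌋).toNat : ℕ) : ℝ)
      = (⌊R / s i⌋ : ℝ) + 1 - (⌊-R / s i⌋ : ℝ) := by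
    rw [← Int.cast_natCast, Int.toNat_of_nonneg (by linarith)]
    push_cast
    ring
  rw [h4, neg_div]
  have h5 : 2 * R / s i = 2 * (R / s i) := by ring
  linarith

end Grid

/-! ### Almost sure closeness of the empirical measures on bandwidth grids -/

section Probability

variable {Ω : Type*} [MeasurableSpace Ω] {μ : Measure Ω} [IsProbabilityMeasure μ] {d : ℕ}
  {Z : ℕ → Ω → Fin d → ℝ}

/-- A one-sided Hoeffding bound for empirical means. -/
lemma measure_empirical_sub_ge_le (hmeas : ∀ n, Measurable (Z n)) (hindep : iIndepFun Z μ)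
    (hident : ∀ n, IdentDistrib (Z n) (Z 0) μ μ) {f : (Fin d → ℝ) → ℝ} (hf : Measurable f)
    (hf1 : ∀ y, |f y| ≤ 1) (N : ℕ) {t : ℝ} (ht : 0 ≤ t) :
    μ.real {ω | N * t ≤ ∑ n ∈ Finset.range N, (f (Z n ω) - ∫ y, f y ∂(μ.map (Z 0)))}
      ≤ Real.exp (-(N * t ^ 2 / 2)) := by
  have hI : iIndepFun (fun n ω => f (Z n ω) - ∫ y, f y ∂(μ.map (Z 0))) μ :=
    hindep.comp (fun _ y => f y - ∫ y, f y ∂(μ.map (Z 0))) fun _ => hf.sub_const _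
  have hsub : ∀ n < N, HasSubgaussianMGF
      (fun ω => f (Z n ω) - ∫ y, f y ∂(μ.map (Z 0))) 1 μ := by
    intro n _
    have h1 := hasSubgaussianMGF_of_mem_Icc (μ := μ) (X := fun ω => f (Z n ω)) (a := -1) (b := 1)
      (hf.comp (hmeas n)).aemeasurable (ae_of_all _ fun ω => abs_le.1 (hf1 _))
    have h2 : ∫ ω, f (Z n ω) ∂μ = ∫ y, f y ∂(μ.map (Z 0)) := by
      rw [← (hident n).map_eq, integral_map (hmeas n).aemeasurable hf.aestronglyMeasurable]
    have h3 : (‖(1 : ℝ) - -1‖₊ / 2) ^ 2 = 1 := by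
      ext
      norm_num
    rwa [h2, h3] at h1
  refine (HasSubgaussianMGF.measure_sum_range_ge_le_of_iIndepFun hI hsub
    (by positivity)).trans (le_of_eq ?_)
  congr 1
  rcases Nat.eq_zero_or_pos N with rfl | hN
  · simp
  · have : (N : ℝ) ≠ 0 := by exact_mod_cast hN.ne'
    simp only [NNReal.coe_one]
    field_simp

/-- Almost sure uniform one-sided closeness over all sign functions on `o(N)` many cells. -/
lemma ae_eventually_signOn_le (hmeas : ∀ n, Measurable (Z n)) (hindep : iIndepFun Z μ)
    (hident : ∀ n, IdentDistrib (Z n) (Z 0) μ μ) [DecidableEq (Fin d → ℤ)] (s : ℕ → Fin d → ℝ)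
    (F : ℕ → Finset (Fin d → ℤ))
    (hF : Tendsto (fun N => ((F N).card : ℝ) / N) atTop (𝓝 0)) {t : ℝ} (ht : 0 < t) :
    ∀ᵐ ω ∂μ, ∀ᶠ N in atTop, ∀ S ⊆ F N,
      ∫ y, signOn (F N) S (cell (s N) y) ∂(empirical (sample (fun n => Z n ω) N))
        - ∫ y, signOn (F N) S (cell (s N) y) ∂(μ.map (Z 0)) ≤ t := by
  let f : ℕ → Finset (Fin d → ℤ) → (Fin d → ℝ) → ℝ := fun N S y => signOn (F N) S (cell (s N) y)
  have hfm : ∀ N S, Measurable (f N S) := fun N S => measurable_comp_cell (signOn (F N) S) (s N)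
  -- The exceptional event at sample size `N`: some one of the 2^|F N| sign patterns deviates by at
  -- least t.
  let E : ℕ → Set Ω := fun N => ⋃ S ∈ (F N).powerset,
    {ω | N * t ≤ ∑ n ∈ Finset.range N, (f N S (Z n ω) - ∫ y, f N S y ∂(μ.map (Z 0)))}
  have hE : ∀ N, μ.real (E N) ≤ 2 ^ (F N).card * Real.exp (-(N * t ^ 2 / 2)) := by
    intro N
    refine (measureReal_biUnion_finset_le _ _).trans ((Finset.sum_le_sum fun S _ =>
      measure_empirical_sub_ge_le hmeas hindep hident (hfm N S)
        (fun y => abs_signOn_le _ _ _) N ht.le).trans (le_of_eq ?_))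
    rw [Finset.sum_const, Finset.card_powerset, nsmul_eq_mul]
    push_cast
    rfl
  -- Once |F N| < N t²/4, the bound 2 ≤ e shows that the number of patterns costs at most half of
  -- the Hoeffding exponent. What is left is geometric, and Borel–Cantelli applies.
  have hev : ∀ᶠ N : ℕ in atTop, μ.real (E N) ≤ Real.exp (-(t ^ 2 / 4)) ^ N := by
    filter_upwards [hF.eventually (gt_mem_nhds (by positivity : 0 < t ^ 2 / 4)),
      eventually_ge_atTop 1] with N hN hN1
    have hN0 : (0 : ℝ) < N := by exact_mod_cast hN1
    rw [div_lt_iff₀ hN0] at hN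
    refine (hE N).trans ?_
    have h2 : (2 : ℝ) ^ (F N).card ≤ Real.exp ((F N).card) := by
      rw [← mul_one ((F N).card : ℝ), Real.exp_nat_mul]
      exact pow_le_pow_left₀ zero_le_two (by linarith [Real.add_one_le_exp 1]) _
    calc (2 : ℝ) ^ (F N).card * Real.exp (-(N * t ^ 2 / 2))
        ≤ Real.exp ((F N).card) * Real.exp (-(N * t ^ 2 / 2)) :=
          mul_le_mul_of_nonneg_right h2 (Real.exp_pos _).le
      _ = Real.exp ((F N).card - N * t ^ 2 / 2) := by rw [← Real.exp_add, sub_eq_add_neg]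
      _ ≤ Real.exp (N * -(t ^ 2 / 4)) := Real.exp_le_exp.2 (by linarith)
      _ = _ := Real.exp_nat_mul _ _
  obtain ⟨N₀, hN₀⟩ := eventually_atTop.1 hev
  have hsum : ∑' N, μ (E (N + N₀)) ≠ ⊤ := by
    have hr1 : Real.exp (-(t ^ 2 / 4)) < 1 := by
      have : 0 < t ^ 2 := by positivity
      rw [← Real.exp_zero]
      exact Real.exp_lt_exp.2 (by linarith)
    have hsm : Summable fun N : ℕ => Real.exp (-(t ^ 2 / 4)) ^ (N + N₀) :=
      (summable_nat_add_iff N₀).2 (summable_geometric_of_lt_one (Real.exp_pos _).le hr1)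
    refine ne_top_of_le_ne_top hsm.tsum_ofReal_ne_top (ENNReal.tsum_le_tsum fun N => ?_)
    rw [← ofReal_measureReal (measure_ne_top μ _)]
    exact ENNReal.ofReal_le_ofReal (hN₀ _ (by lia))
  filter_upwards [ae_eventually_notMem hsum] with ω hω
  obtain ⟨N₁, hN₁⟩ := eventually_atTop.1 hω
  filter_upwards [eventually_ge_atTop (N₀ + N₁), eventually_ge_atTop 1] with N hN hN1 S hS
  have h1 := hN₁ (N - N₀) (by lia)
  rw [Nat.sub_add_cancel (by lia)] at h1
  have hN0 : (0 : ℝ) < N := by exact_mod_cast hN1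
  simp only [E, Set.mem_iUnion, not_exists, Finset.mem_powerset] at h1
  have h2 := h1 S hS
  simp only [Set.mem_ofPred_eq, not_le, Finset.sum_sub_distrib, Finset.sum_const,
    Finset.card_range, nsmul_eq_mul] at h2
  have h3 : ∑ n : Fin N, f N S (Z n ω) = ∑ n ∈ Finset.range N, f N S (Z n ω) :=
    Fin.sum_univ_eq_sum_range (fun n => f N S (Z n ω)) N
  rw [integral_empirical]
  change (∑ n : Fin N, f N S (Z n ω)) / N - ∫ y, f N S y ∂(μ.map (Z 0)) ≤ t
  rw [h3, sub_le_iff_le_add, div_le_iff₀ hN0]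
  linarith

/-- The empirical measures almost surely merge with the common law on the grids of mesh
proportional to the bandwidths. -/
lemma ae_merge_empirical (hmeas : ∀ n, Measurable (Z n)) (hindep : iIndepFun Z μ)
    (hident : ∀ n, IdentDistrib (Z n) (Z 0) μ μ) {h : ℕ → Fin d → ℝ} (hpos : ∀ N i, 0 < h N i)
    (hzero : ∀ i, Tendsto (fun N => h N i) atTop (𝓝 0))
    (hinfty : Tendsto (fun N : ℕ => (N : ℝ) * ∏ i, h N i) atTop atTop) :
    ∀ᵐ ω ∂μ, Merge h (fun N => empirical (sample (fun n => Z n ω) N)) (μ.map (Z 0)) := by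
  classical
  have hprob : IsProbabilityMeasure (μ.map (Z 0)) :=
    Measure.isProbabilityMeasure_map (hmeas 0).aemeasurable
  have hle1 : ∀ᶠ N in atTop, ∀ i, h N i ≤ 1 := eventually_all.2 fun i =>
    ((hzero i).eventually (gt_mem_nhds one_pos)).mono fun N hN => hN.le
  -- A fixed box meets O(1/∏ h_i) cells, so N ∏ h_i → ∞ is just what makes their number o(N).
  have hcard : ∀ k R : ℕ, Tendsto (fun N : ℕ =>
      ((boxCells (fun i => ((k : ℝ) + 1)⁻¹ * h N i) R).card : ℝ) / N) atTop (𝓝 0) := by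
    intro k R
    have hlim : Tendsto (fun N : ℕ => (2 * (R : ℝ) * (k + 1) + 2) ^ d *
        ((N : ℝ) * ∏ i, h N i)⁻¹) atTop (𝓝 0) := by
      simpa using hinfty.inv_tendsto_atTop.const_mul ((2 * (R : ℝ) * (k + 1) + 2) ^ d)
    refine squeeze_zero' (Eventually.of_forall fun N => by positivity) ?_ hlim
    filter_upwards [hle1] with N hN
    have hs : ∀ i, 0 < ((k : ℝ) + 1)⁻¹ * h N i := fun i => mul_pos (by positivity) (hpos N i)
    rw [mul_inv, mul_left_comm, div_eq_inv_mul]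
    refine mul_le_mul_of_nonneg_left ?_ (by positivity)
    refine (card_boxCells_le hs (Nat.cast_nonneg R)).trans ?_
    rw [← Fin.prod_const, ← Finset.prod_inv_distrib, ← Finset.prod_mul_distrib]
    refine Finset.prod_le_prod (fun i _ => ?_) fun i _ => ?_
    · have := div_nonneg (by positivity : 0 ≤ 2 * (R : ℝ)) (hs i).le
      linarith
    · have h0 := hpos N i
      rw [← div_eq_mul_inv, le_div_iff₀ h0]
      have : (2 * (R : ℝ) / (((k : ℝ) + 1)⁻¹ * h N i) + 2) * h N i
          = 2 * R * (k + 1) + 2 * h N i := by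
        field_simp
      rw [this]
      linarith [hN i]
  -- Mesh, radius and tolerance run over countable families, so a single null set serves all of
  -- them.
  have hae : ∀ᵐ ω ∂μ, ∀ k R m : ℕ, ∀ᶠ N in atTop,
      ∀ S ⊆ boxCells (fun i => ((k : ℝ) + 1)⁻¹ * h N i) R,
        ∫ y, signOn (boxCells (fun i => ((k : ℝ) + 1)⁻¹ * h N i) R) S
            (cell (fun i => ((k : ℝ) + 1)⁻¹ * h N i) y)
          ∂(empirical (sample (fun n => Z n ω) N))
        - ∫ y, signOn (boxCells (fun i => ((k : ℝ) + 1)⁻¹ * h N i) R) S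
            (cell (fun i => ((k : ℝ) + 1)⁻¹ * h N i) y) ∂(μ.map (Z 0)) ≤ 1 / ((m : ℝ) + 1) := by
    simp only [ae_all_iff]
    intro k R m
    exact ae_eventually_signOn_le hmeas hindep hident (fun N i => ((k : ℝ) + 1)⁻¹ * h N i)
      (fun N => boxCells (fun i => ((k : ℝ) + 1)⁻¹ * h N i) R) (hcard k R) (by positivity)
  filter_upwards [hae] with ω hω k ε hε
  -- With p = 0 the weight is 1 and its tail is the indicator of norm greater than R, so this yields
  -- tightness of the common law.
  have hi : Integrable (fun y : Fin d → ℝ => momentWeight 0 ‖y‖) (μ.map (Z 0)) := by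
    simp [momentWeight]
  obtain ⟨R, hR⟩ := ((tendsto_integral_tailWeight (p := 0) measurable_norm hi).eventually
    (gt_mem_nhds (by positivity : 0 < ε / 4))).exists
  obtain ⟨m, hm⟩ := exists_nat_one_div_lt (by positivity : 0 < ε / 4)
  filter_upwards [hω k R m, eventually_ge_atTop 1] with N hN hN1
  have : NeZero N := ⟨by lia⟩
  have hs : ∀ i, 0 < ((k : ℝ) + 1)⁻¹ * h N i := fun i => mul_pos (by positivity) (hpos N i)
  have hout : ∫ y, (if cell (fun i => ((k : ℝ) + 1)⁻¹ * h N i) y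
      ∈ boxCells (fun i => ((k : ℝ) + 1)⁻¹ * h N i) R then (0 : ℝ) else 1) ∂(μ.map (Z 0))
      ≤ ε / 4 := by
    refine le_trans (integral_mono ?_ (integrable_tailWeight measurable_norm hi R) fun y => ?_) hR.le
    · exact integrable_of_abs_le (B := 1) (measurable_comp_cell (fun c => if c ∈
        boxCells (fun i => ((k : ℝ) + 1)⁻¹ * h N i) R then 0 else 1) _)
        fun y => by split_ifs <;> simp
    · simp only [tailWeight, momentWeight, pow_zero]
      split_ifs with c1 c2 c2
      · exact zero_le_one
      · exact le_rfl
      · exact le_rfl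
      · exact absurd (cell_mem_boxCells hs (by simpa using c2)) c1
  intro φ hφ
  refine (CellClose.of_signOn hN hout φ hφ).trans ?_
  linarith

end Probability

/-! ### Monomials and the decorrelation loss -/

section Moments

variable {d : ℕ}

/-- The monomial with exponents `e`. -/
def monomial (e : Fin d → ℕ) (x : Fin d → ℝ) : ℝ := ∏ k, x k ^ e k

lemma monomial_single (i : Fin d) (a : ℕ) (x : Fin d → ℝ) :
    monomial (Pi.single i a) x = x i ^ a := by
  rw [monomial, Finset.prod_eq_single i (fun k _ hk => by simp [hk]) (by simp)]
  simp

lemma monomial_add (e e' : Fin d → ℕ) (x : Fin d → ℝ) :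
    monomial (e + e') x = monomial e x * monomial e' x := by
  simp [monomial, pow_add, Finset.prod_mul_distrib]

lemma continuous_monomial (e : Fin d → ℕ) : Continuous (monomial e) := by
  unfold monomial
  fun_prop

lemma abs_monomial_le {p : ℕ} {e : Fin d → ℕ} (he : ∀ k, e k ≤ p) (x : Fin d → ℝ) :
    |monomial e x| ≤ ∏ k, momentWeight p (x k) := by
  rw [monomial, Finset.abs_prod]
  refine Finset.prod_le_prod (fun _ _ => abs_nonneg _) fun k _ => ?_
  rw [abs_pow]
  exact abs_pow_le_momentWeight (he k) _

lemma integral_monomial (m : Fin d → Measure ℝ) [∀ i, IsProbabilityMeasure (m i)]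
    (e : Fin d → ℕ) :
    ∫ y, monomial e y ∂(Measure.pi m) = ∏ k, ∫ t, t ^ e k ∂(m k) :=
  integral_fintype_prod_eq_prod (f := fun k t => t ^ e k)

/-- The factors match coordinate by coordinate, because a coordinate with exponent 0 contributes the
total mass 1. This makes every limiting covariance in the loss vanish. -/
lemma integral_monomial_single_add (m : Fin d → Measure ℝ) [∀ i, IsProbabilityMeasure (m i)]
    {i j : Fin d} (hij : j ≠ i) (a b : ℕ) :
    ∫ y, monomial (Pi.single i a + Pi.single j b) y ∂(Measure.pi m)
      = (∫ y, monomial (Pi.single i a) y ∂(Measure.pi m))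
        * ∫ y, monomial (Pi.single j b) y ∂(Measure.pi m) := by
  rw [integral_monomial, integral_monomial, integral_monomial, ← Finset.prod_mul_distrib]
  refine Finset.prod_congr rfl fun k _ => ?_
  rcases eq_or_ne k i with rfl | hk
  · simp [hij.symm]
  · simp [hk]

end Moments

section Loss

variable {d : ℕ} {w : ∀ N : ℕ, Fin N → ℝ} {z : ℕ → Fin d → ℝ} {O : ℕ}

/-- The loss vanishes in the limit when the weighted moments converge to those of a product
measure. -/
lemma tendsto_decorrelationLoss {m : Fin d → Measure ℝ} [∀ i, IsProbabilityMeasure (m i)]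
    (hw : ∀ e : Fin d → ℕ, (∀ k, e k ≤ O) → Tendsto (fun N => (∑ n, w N n * monomial e (z n)) / N)
      atTop (𝓝 (∫ y, monomial e y ∂(Measure.pi m)))) :
    Tendsto (fun N => decorrelationLoss O (sample z N) (w N)) atTop (𝓝 0) := by
  have hsingle : ∀ (i : Fin d) (a : ℕ), a ≤ O → ∀ k, (Pi.single i a : Fin d → ℕ) k ≤ O := by
    intro i a ha k
    rcases eq_or_ne k i with rfl | hk
    · simpa
    · simp [hk]
  have hpair : ∀ (i j : Fin d) (a b : ℕ), j ≠ i → a ≤ O → b ≤ O →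
      ∀ k, (Pi.single i a + Pi.single j b : Fin d → ℕ) k ≤ O := by
    intro i j a b hij ha hb k
    rcases eq_or_ne k i with rfl | hk
    · simpa [hij.symm]
    · simpa [hk] using hsingle j b hb k
  have key : ∀ i : Fin d, ∀ a ∈ Finset.Icc 1 O, ∀ b ∈ Finset.Icc 1 O,
      ∀ j ∈ Finset.univ.erase i, Tendsto (fun N : ℕ =>
        ((∑ n, sample z N n i ^ a * w N n * sample z N n j ^ b) / (N : ℝ)
          - ((∑ n, sample z N n i ^ a * w N n) / (N : ℝ))
            * ((∑ n, sample z N n j ^ b * w N n) / (N : ℝ))) ^ 2) atTop (𝓝 0) := by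
    intro i a ha b hb j hj
    have hij := Finset.ne_of_mem_erase hj
    have ha' := (Finset.mem_Icc.1 ha).2
    have hb' := (Finset.mem_Icc.1 hb).2
    have t := ((hw _ (hpair i j a b hij ha' hb')).sub
      ((hw _ (hsingle i a ha')).mul (hw _ (hsingle j b hb')))).pow 2
    rw [integral_monomial_single_add m hij, sub_self, zero_pow two_ne_zero] at t
    refine t.congr fun N => ?_
    have e1 : ∑ n : Fin N, w N n * (z n i ^ a * z n j ^ b)
        = ∑ n : Fin N, z n i ^ a * w N n * z n j ^ b :=
      Finset.sum_congr rfl fun n _ => by ring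
    have e2 : ∀ (k : Fin d) (c : ℕ), ∑ n : Fin N, w N n * z n k ^ c
        = ∑ n : Fin N, z n k ^ c * w N n := fun k c => Finset.sum_congr rfl fun n _ => by ring
    simp only [monomial_add, monomial_single, sample, e1, e2]
  have := tendsto_finsetSum Finset.univ fun i _ => tendsto_finsetSum (Finset.Icc 1 O) fun a ha =>
    tendsto_finsetSum (Finset.Icc 1 O) fun b hb => tendsto_finsetSum (Finset.univ.erase i)
      fun j hj => key i a ha b hb j hj
  simp only [Finset.sum_const_zero] at this
  exact this

end Loss

/-! ### Strong law and conclusion -/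

/-- The strong law of large numbers for functions of the sample. -/
lemma ae_tendsto_mean {Ω : Type*} [MeasurableSpace Ω] {μ : Measure Ω} {d : ℕ}
    {Z : ℕ → Ω → Fin d → ℝ} (hmeas : ∀ n, Measurable (Z n)) (hindep : iIndepFun Z μ)
    (hident : ∀ n, IdentDistrib (Z n) (Z 0) μ μ) {f : (Fin d → ℝ) → ℝ} (hf : Measurable f)
    (hfi : Integrable f (μ.map (Z 0))) :
    ∀ᵐ ω ∂μ, Tendsto (fun N : ℕ => (∑ n : Fin N, f (Z n ω)) / N) atTop
      (𝓝 (∫ y, f y ∂(μ.map (Z 0)))) := by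
  have h := strong_law_ae_real (fun n ω => f (Z n ω))
    ((integrable_map_measure hf.aestronglyMeasurable (hmeas 0).aemeasurable).1 hfi)
    (fun i j hij => (hindep.indepFun hij).comp hf hf) (fun n => (hident n).comp hf)
  filter_upwards [h] with ω hω
  rw [integral_map (hmeas 0).aemeasurable hf.aestronglyMeasurable]
  refine hω.congr fun N => ?_
  rw [← Fin.sum_univ_eq_sum_range (fun n => f (Z n ω)) N]

section Main

variable {Ω : Type*} [MeasurableSpace Ω] {μ : Measure Ω} [IsProbabilityMeasure μ] {d : ℕ}
  {Z : ℕ → Ω → Fin d → ℝ}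

/-- Almost surely, the moments of the sample under the normalised kernel density ratios converge to
those of the product of the marginals. -/
lemma ae_tendsto_sum_productWeight_monomial {O : ℕ} (hmeas : ∀ n, Measurable (Z n))
    (hindep : iIndepFun Z μ) (hident : ∀ n, IdentDistrib (Z n) (Z 0) μ μ)
    (hdens : μ.map (Z 0) ≪ (volume : Measure (Fin d → ℝ)))
    (hoverlap : Measure.pi (fun i => μ.map (fun ω => Z 0 ω i)) ≪ μ.map (Z 0))
    (hmoment : ∀ i, Integrable (fun ω => |Z 0 ω i| ^ O) μ)
    {K : ℝ → ℝ} (hK : IsSmoothingKernel K) (hKmoment : Integrable (fun u => |u| ^ O * K u))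
    {h : ℕ → Fin d → ℝ} (hpos : ∀ N i, 0 < h N i)
    (hzero : ∀ i, Tendsto (fun N => h N i) atTop (𝓝 0))
    (hinfty : Tendsto (fun N : ℕ => (N : ℝ) * ∏ i, h N i) atTop atTop) :
    ∀ᵐ ω ∂μ, ∀ e : Fin d → ℕ, (∀ k, e k ≤ O) → Tendsto (fun N => ∑ n,
      productWeight K (h N) (sample (fun n => Z n ω) N) n * monomial e (Z n ω)) atTop
        (𝓝 (∫ y, monomial e y ∂(Measure.pi fun i => μ.map fun ω => Z 0 ω i))) := by
  have hprob : IsProbabilityMeasure (μ.map (Z 0)) :=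
    Measure.isProbabilityMeasure_map (hmeas 0).aemeasurable
  have hmarg : ∀ i, (μ.map fun ω => Z 0 ω i) = (μ.map (Z 0)).map fun y => y i := fun i => by
    rw [Measure.map_map (measurable_pi_apply i) (hmeas 0)]
    rfl
  have hi : ∀ i, Integrable (fun y : Fin d → ℝ => momentWeight O (y i)) (μ.map (Z 0)) := fun i => by
    refine integrable_momentWeight (measurable_pi_apply i) ?_
    exact (integrable_map_measure ((continuous_abs.comp (continuous_apply i)).pow O).aestronglyMeasurable
      (hmeas 0).aemeasurable).2 (hmoment i)
  have hmom : ∀ᵐ ω ∂μ, ∀ i, Tendsto (fun N : ℕ => (∑ n : Fin N, momentWeight O (Z n ω i)) / N)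
      atTop (𝓝 (∫ y, momentWeight O (y i) ∂(μ.map (Z 0)))) := ae_all_iff.2 fun i =>
    ae_tendsto_mean hmeas hindep hident
      ((measurable_momentWeight O).comp (measurable_pi_apply i)) (hi i)
  have htail : ∀ᵐ ω ∂μ, ∀ i, ∀ R : ℕ,
      Tendsto (fun N : ℕ => (∑ n : Fin N, tailWeight O R (Z n ω i)) / N)
      atTop (𝓝 (∫ y, tailWeight O R (y i) ∂(μ.map (Z 0)))) :=
    ae_all_iff.2 fun i => ae_all_iff.2 fun R => ae_tendsto_mean hmeas hindep hident
      ((measurable_tailWeight O R).comp (measurable_pi_apply i))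
      (integrable_tailWeight (measurable_pi_apply i) (hi i) R)
  filter_upwards [ae_merge_empirical hmeas hindep hident hpos hzero hinfty, hmom, htail]
    with ω h1 h2 h3 e he
  exact tendsto_sum_productWeight_mul_of_le hK hKmoment hpos hzero (by simp_rw [hmarg])
    hdens hoverlap h1 hi h2 h3 (continuous_monomial e) (abs_monomial_le he)

end Main

end Decorrelation

end

open Decorrelation
theorem lemma1 {Ω : Type*} [MeasurableSpace Ω] (μ : Measure Ω) [IsProbabilityMeasure μ]
    (d O : ℕ)
    -- an i.i.d. sequence of representations in `ℝ^d`
    (Z : ℕ → Ω → Fin d → ℝ)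
    (hmeas : ∀ n, Measurable (Z n))
    (hindep : iIndepFun Z μ)
    (hident : ∀ n, IdentDistrib (Z n) (Z 0) μ μ)
    -- the common law has a density
    (hdens : μ.map (Z 0) ≪ (volume : Measure (Fin d → ℝ)))
    -- overlap: the product of the marginal laws is absolutely continuous w.r.t. the joint law
    (hoverlap : Measure.pi (fun i => μ.map (fun ω => Z 0 ω i)) ≪ μ.map (Z 0))
    -- the moments occurring in the loss exist
    (hmoment : ∀ i, Integrable (fun ω => |Z 0 ω i| ^ O) μ)
    (K : ℝ → ℝ) (hK : IsSmoothingKernel K) (hKmoment : Integrable (fun u => |u| ^ O * K u))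
    -- the bandwidths `h N i` for sample size `N`
    (h : ℕ → Fin d → ℝ) (hpos : ∀ N i, 0 < h N i)
    (hzero : ∀ i, Tendsto (fun N => h N i) atTop (𝓝 0))
    (hinfty : Tendsto (fun N : ℕ => (N : ℝ) * ∏ i, h N i) atTop atTop) :
    (∀ᵐ ω ∂μ, ∃ W : ∀ N : ℕ, Fin N → ℝ,
      (∀ N n, 0 ≤ W N n) ∧ (∀ N, ∑ n, W N n = (N : ℝ)) ∧
      Tendsto (fun N => decorrelationLoss O (sample (fun n => Z n ω) N) (W N)) atTop (𝓝 0)) ∧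
    (∀ᵐ ω ∂μ,
      (∀ (N : ℕ) (n : Fin N),
        0 < jointKDE K (h N) (sample (fun n => Z n ω) N) (Z n ω) ∧
        0 ≤ kdeWeight K (h N) (sample (fun n => Z n ω) N) n) ∧
      Tendsto (fun N => decorrelationLoss O (sample (fun n => Z n ω) N)
        (kdeWeight K (h N) (sample (fun n => Z n ω) N))) atTop (𝓝 0)) := by
  have hmarg : ∀ i, IsProbabilityMeasure (μ.map fun ω => Z 0 ω i) := fun i =>
    Measure.isProbabilityMeasure_map ((measurable_pi_apply i).comp (hmeas 0)).aemeasurable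
  have hae := ae_tendsto_sum_productWeight_monomial hmeas hindep hident hdens hoverlap hmoment hK
    hKmoment hpos hzero hinfty
  have hkde : ∀ (ω : Ω) (N : ℕ) (n : Fin N), kdeWeight K (h N) (sample (fun n => Z n ω) N) n
      = N * productWeight K (h N) (sample (fun n => Z n ω) N) n := fun ω N n =>
    kdeWeight_eq (hpos N) _ n
  have hN : ∀ {N : ℕ}, Fin N → (N : ℝ) ≠ 0 := fun n => by exact_mod_cast n.pos.ne'
  have hw0 : ∀ (ω : Ω) (N : ℕ) (n : Fin N),
      0 < productWeight K (h N) (sample (fun n => Z n ω) N) n := fun ω N n =>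
    productWeight_pos hK _ _ n
  constructor
  · filter_upwards [hae] with ω hω
    -- The weights need not sum to N exactly. The moment convergence with exponent 0 gives `S` → 1,
    -- so dividing by `S` changes no limit.
    set S : ℕ → ℝ := fun N => ∑ n, productWeight K (h N) (sample (fun n => Z n ω) N) n with hS
    have hS1 : Tendsto S atTop (𝓝 1) := by
      simpa [monomial] using hω 0 fun k => Nat.zero_le _
    refine ⟨fun N n => (S N)⁻¹ * kdeWeight K (h N) (sample (fun n => Z n ω) N) n,
      fun N n => ?_, fun N => ?_, tendsto_decorrelationLoss
      (m := fun i => μ.map fun ω => Z 0 ω i) fun e he => ?_⟩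
    · simp only [hkde]
      exact mul_nonneg (inv_nonneg.2 (Finset.sum_nonneg fun n _ => (hw0 ω N n).le))
        (mul_nonneg (Nat.cast_nonneg N) (hw0 ω N n).le)
    · rw [← Finset.mul_sum]
      simp_rw [hkde]
      rw [← Finset.mul_sum]
      -- For N = 0 both sides are 0; otherwise `S N` is positive and may be cancelled.
      rcases Nat.eq_zero_or_pos N with rfl | hN
      · simp
      · have : 0 < S N := Finset.sum_pos (fun n _ => hw0 ω N n) ⟨⟨0, hN⟩, Finset.mem_univ _⟩
        change (S N)⁻¹ * (N * S N) = N
        field_simp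
    · have t := (hS1.inv₀ one_ne_zero).mul (hω e he)
      rw [inv_one, one_mul] at t
      refine t.congr fun N => ?_
      rw [Finset.mul_sum, Finset.sum_div]
      refine Finset.sum_congr rfl fun n _ => ?_
      rw [hkde]
      have := hN n
      field_simp
  · filter_upwards [hae] with ω hω
    refine ⟨fun N n => ⟨jointKDE_pos hK (hpos N) _ n, ?_⟩, tendsto_decorrelationLoss
      (m := fun i => μ.map fun ω => Z 0 ω i) fun e he => ?_⟩
    · rw [hkde]
      exact mul_nonneg (Nat.cast_nonneg N) (hw0 ω N n).le
    · refine (hω e he).congr fun N => ?_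
      rw [Finset.sum_div]
      refine Finset.sum_congr rfl fun n _ => ?_
      rw [hkde]
      have := hN n
      field_simp
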